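/- **Conventions.** A space is *zero-dimensional* if its clopen subsets form a basis of its topology; 0DMS, 0DP and 0DMC abbreviate zero-dimensional metrizable separable, zero-dimensional Polish and zero-dimensional metrizable compact. A *graph* on a set $X$ is a symmetric irreflexive binary relation on $X$. The *continuous chromatic number* (CCN) of a graph $G$ on a space $X$ is the least cardinal $\kappa\le\aleph_0$ for which there is a continuous map $c:X\to\kappa$ ($\kappa$ discrete) with $c(x)\ne c(y)$ whenever $(x,y)\in G$ if there is one, and $2^{\aleph_0}$ otherwise. We write $(X,G)\preceq^i_c(Y,H)$ if there is an injective continuous $\varphi:X\to Y$ such that $(x,y)\in G$ implies $(\varphi(x),\varphi(y))\in H$; $(X,G)$ is *strictly* $\preceq^i_c$-below $(Y,H)$ if moreover $(Y,H)\not\preceq^i_c(X,G)$. An element $\Gamma$ of a class is *$\preceq^i_c$-minimal* in it if $\Gamma\preceq^i_c\Delta$ for any $\Delta$ of the class with $\Delta\preceq^i_c\Gamma$. A *basis* for a class is a subclass such that any element of the class is $\preceq^i_c$-above an element of the subclass; it is an *antichain basis* if its distinct elements are pairwise $\preceq^i_c$-incomparable. For $f:X\to X$, the graph *induced* by $f$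 is $G_f=\{(x,y)\in X^2\mid x\ne y\text{ and }(f(x)=y\text{ or }f(y)=x)\}$. Let $\mathfrak G_2$ be the class of graphs induced by a (total) homeomorphism of a 0DMC space with CCN strictly bigger than $2$. A graph on $X$ is *closed* if it is a closed subset of $X^2$. Let $\sigma$ be the shift on $2^{\mathbb Z}$, $\sigma(x)(n)=x(n+1)$. Let $\alpha_0\in 2^{\mathbb Z}$ be defined by $\alpha_0(n)=1$ iff $n$ is odd, and $\beta_0\in 2^{\mathbb Z}$ by: for $n<0$, $\beta_0(n)=1$ iff $n$ is odd; for $n\ge 0$, $\beta_0(n)=1$ iff $n$ is even. Let $K_0=\{\sigma^k(\alpha_0)\mid k\in\mathbb Z\}\cup\{\sigma^k(\beta_0)\mid k\in\mathbb Z\}$, with the topology induced by $2^{\mathbb Z}$, and let $h_0=\sigma_{|K_0}$. **Theorem 1.14.** $K_0$ is a countable 0DMC space, it is closed in $2^{\mathbb Z}$ and $\sigma[K_0]=K_0$ (so that $K_0$ is a two-sided subshift), $h_0$ is a homeomorphism of $K_0$, and the following hold. (a) $(K_0,G_{h_0})$ has CCN three, and it belongs to, and is $\preceq^i_c$-minimal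 in, both $\mathfrak G_2$ and the class of closed graphs on a 0DMC space with CCN at least three. (b) If $S$ is a 0DMS (resp., 0DP) space and $f$ is a homeomorphism of $S$ such that $(S,G_f)$ has CCN at least three and $(S,G_f)\preceq^i_c(K_0,G_{h_0})$, then there is a 0DMS (resp., 0DP) topology $\tau$ on $K_0$, finer than the topology of $K_0$, such that $h_0$ is a homeomorphism of $(K_0,\tau)$, $\big((K_0,\tau),G_{h_0}\big)$ has CCN three, and $\big((K_0,\tau),G_{h_0}\big)$ is strictly $\preceq^i_c$-below $(S,G_f)$. In particular, there is no $\preceq^i_c$-antichain basis for the class of graphs induced by a (total) homeomorphism of a 0DMS space with CCN at least three, and none for the class of graphs induced by a (total) homeomorphism of a 0DP space with CCN at least three. Also, any $\preceq^i_c$-basis for one of these two classes has size at least continuum. -/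

import Mathlib

open Cardinal

universe u v

namespace ContGraph

/-! ### Zero-dimensional spaces -/

/-- The clopen subsets of `X` form a basis of its topology. -/
def ClopenBasis (X : Type u) [TopologicalSpace X] : Prop :=
  TopologicalSpace.IsTopologicalBasis {s : Set X | IsClopen s}

/-- `0DMS`: zero-dimensional metrizable separable spaces. -/
def Is0DMS (X : Type u) [TopologicalSpace X] : Prop :=
  ClopenBasis X ∧ TopologicalSpace.MetrizableSpace X ∧ TopologicalSpace.SeparableSpace X

/-- `0DP`: zero-dimensional Polish spaces. -/
def Is0DP (X : Type u) [TopologicalSpace X] : Prop :=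
  ClopenBasis X ∧ PolishSpace X

/-- `0DMC`: zero-dimensional metrizable compact spaces. -/
def Is0DMC (X : Type u) [TopologicalSpace X] : Prop :=
  ClopenBasis X ∧ TopologicalSpace.MetrizableSpace X ∧ CompactSpace X

/-! ### Graphs on topological spaces -/

/-- A topological space together with a (symmetric, irreflexive) graph on it. No compatibility between the graph
and the topology is required. -/
structure TopGraph where
  V : Type u
  top : TopologicalSpace V
  graph : SimpleGraph V

instance (Γ : TopGraph.{u}) : TopologicalSpace Γ.V := Γ.top

/-- There is a continuous coloring with values in `C`, equipped with the discrete topology.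
(`IsLocallyConstant c` says that all preimages under `c` are open.) -/
def TopGraph.HasContColoring (Γ : TopGraph.{u}) (C : Type v) : Prop :=
  ∃ c : Γ.V → C, IsLocallyConstant c ∧ ∀ x y, Γ.graph.Adj x y → c x ≠ c y

/-- The continuous chromatic number: the least cardinal `κ ≤ ℵ₀` for which there is a continuous
coloring with values in a discrete space of size `κ` if there is one, and `2 ^ ℵ₀` otherwise. -/
noncomputable def TopGraph.ccn (Γ : TopGraph.{u}) : Cardinal.{0} :=
  sInf ({κ : Cardinal.{0} | κ ≤ ℵ₀ ∧ Γ.HasContColoring κ.out} ∪ {𝔠})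

/-- `Γ ≼ Δ`: there is an injective continuous homomorphism from `Γ` to `Δ`. -/
def TopGraph.Below (Γ : TopGraph.{u}) (Δ : TopGraph.{v}) : Prop :=
  ∃ φ : Γ.V → Δ.V, Continuous φ ∧ Function.Injective φ ∧
    ∀ x y, Γ.graph.Adj x y → Δ.graph.Adj (φ x) (φ y)

/-- The graph is a closed subset of the square of the space. -/
def TopGraph.IsClosedGraph (Γ : TopGraph.{u}) : Prop :=
  IsClosed {p : Γ.V × Γ.V | Γ.graph.Adj p.1 p.2}

/-- The graph induced by a function `f`: distinct `x`, `y` are adjacent if and only if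
`f x = y` or `f y = x`. -/
def inducedGraph {X : Type u} (f : X → X) : SimpleGraph X :=
  SimpleGraph.fromRel fun x y => f x = y

/-- The graph `(X, G_f)` induced by a function on the topological space `(X, t)`. -/
def graphOf {X : Type u} (t : TopologicalSpace X) (f : X → X) : TopGraph.{u} :=
  ⟨X, t, inducedGraph f⟩

/-- The graph is induced by a (total) homeomorphism of the space. -/
def TopGraph.HomeoInduced (Γ : TopGraph.{u}) : Prop :=
  ∃ f : Γ.V ≃ₜ Γ.V, Γ.graph = inducedGraph f

/-! ### Classes of graphs -/

/-- The class `𝔊_κ` of the graphs induced by a homeomorphism of a 0DMC space, with continuous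
chromatic number strictly bigger than `κ`. -/
def frakG (κ : Cardinal.{0}) : Set TopGraph.{u} :=
  {Γ | Is0DMC Γ.V ∧ Γ.HomeoInduced ∧ κ < Γ.ccn}

/-- The closed graphs on a 0DMC space with continuous chromatic number at least three. -/
def closedClass : Set TopGraph.{u} :=
  {Γ | Is0DMC Γ.V ∧ Γ.IsClosedGraph ∧ 3 ≤ Γ.ccn}

/-- The graphs induced by a homeomorphism of a 0DMS space, with continuous chromatic number at
least three. -/
def homeoClass0DMS : Set TopGraph.{u} :=
  {Γ | Is0DMS Γ.V ∧ Γ.HomeoInduced ∧ 3 ≤ Γ.ccn}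

/-- The graphs induced by a homeomorphism of a 0DP space, with continuous chromatic number at
least three. -/
def homeoClass0DP : Set TopGraph.{u} :=
  {Γ | Is0DP Γ.V ∧ Γ.HomeoInduced ∧ 3 ≤ Γ.ccn}

/-- `B` is a basis for the class `C`: it is a subclass, and any element of `C` is above an element
of `B`. -/
def IsBasisFor (B C : Set TopGraph.{u}) : Prop :=
  B ⊆ C ∧ ∀ Γ ∈ C, ∃ Δ ∈ B, Δ.Below Γ

/-- `B` is an antichain basis for `C`: a basis whose elements are pairwise incomparable. -/
def IsAntichainBasisFor (B C : Set TopGraph.{u}) : Prop :=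
  IsBasisFor B C ∧ IsAntichain TopGraph.Below B

/-! ### The subshift -/

/-- The shift map on `2^ℤ`. -/
def shift : (ℤ → Bool) ≃ₜ (ℤ → Bool) where
  toFun x n := x (n + 1)
  invFun x n := x (n - 1)
  left_inv x := by funext n; simp
  right_inv x := by funext n; simp
  continuous_toFun := by fun_prop
  continuous_invFun := by fun_prop

/-- The two-sided orbit of a point of `2^ℤ` under the shift. -/
def shiftOrbit (x : ℤ → Bool) : Set (ℤ → Bool) :=
  {y | ∃ k : ℤ, y = fun n => x (n + k)}

/-- The sequence `(01)^∞ · (01)^∞`, where the coordinate `0` is the first one after the dot. -/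
def alphaSeq : ℤ → Bool := fun n => decide (Odd n)

/-- The sequence `(01)^∞ · 1(01)^∞`. -/
def betaSeq : ℤ → Bool := fun n => if n < 0 then decide (Odd n) else decide (Even n)

/-- The space `K₀`, with the topology induced by the product topology of `2^ℤ`. -/
def K0 : Set (ℤ → Bool) := shiftOrbit alphaSeq ∪ shiftOrbit betaSeq

theorem mem_shiftOrbit_shift (a x : ℤ → Bool) : x ∈ shiftOrbit a ↔ shift x ∈ shiftOrbit a := by
  constructor
  · rintro ⟨k, rfl⟩
    refine ⟨k + 1, ?_⟩
    funext n
    show a (n + 1 + k) = a (n + (k + 1))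
    congr 1
    ring
  · rintro ⟨k, hk⟩
    refine ⟨k - 1, ?_⟩
    funext n
    have h : x (n - 1 + 1) = a (n - 1 + k) := congrFun hk (n - 1)
    rw [sub_add_cancel] at h
    rw [h]
    congr 1
    ring

/-- The homeomorphism `h₀` of `K₀`: the restriction of the shift. -/
def h0 : K0 ≃ₜ K0 :=
  shift.subtype fun x => or_congr (mem_shiftOrbit_shift alphaSeq x) (mem_shiftOrbit_shift betaSeq x)

/-- The topology of `K₀`, induced by the product topology of `2^ℤ`. -/
abbrev K0Top : TopologicalSpace K0 := instTopologicalSpaceSubtype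

/-- The inverse of `h₀`. -/
def h0Inv : K0 → K0 := h0.symm

/-- The graph `(K₀, G_{h₀})`. -/
def K0Graph : TopGraph.{0} := graphOf K0Top h0

/-- `τ` is finer than the topology of `K₀`, `h₀` is a homeomorphism of `(K₀, τ)`, and
`((K₀, τ), G_{h₀})` has continuous chromatic number three. (`τ ≤ K0Top` says that any open set of
`K0Top` is an open set of `τ`.) -/
def IsRefinement (τ : TopologicalSpace K0) : Prop :=
  τ ≤ K0Top ∧ @Continuous K0 K0 τ τ h0 ∧ @Continuous K0 K0 τ τ h0Inv ∧ (graphOf τ h0).ccn = 3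

end ContGraph

open ContGraph

namespace ContGraph

open Set Filter Topology

/-! ### The points of `K₀` -/

/-! `K0` consists of the isolated points σ^k(β₀) and of the two-cycle {α₀, σ(α₀)}. A two-coloring is
given by the parity of k along the orbit of β₀, but α₀ is a limit both of σ^k(β₀) with k odd, k →
+∞, and with k even, k → -∞. So two continuous colors do not suffice; a third one, marking the
defect of the sequence, does.

The key is rigidity (`exists_adj_betaPt`, `exists_conj`). A graph induced by a homeomorphism, not
two-colorable and injectively mapped to `K0`, must cover each edge of the orbit of β₀, and also the
edge {α₀, σ(α₀)}. It is thus `h0` with a finer topology. On a compact space that topology is the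
original one, which gives minimality; for a closed graph the last edge is a limit of the others.

A refinement is controlled by the trace on ℤ of the neighborhoods of α₀, a filter satisfying
`IsLimitFilter`; conversely any such filter F yields a refinement `limitTop F`, which is
zero-dimensional Polish when F is countably generated (`IsLimitFilter.is0DP`). Inside F one selects
sparse blocks of integers; the blocks indexed by an almost disjoint family of subsets of ℕ generate
continuum many smaller limit filters, pairwise `FarApart`. An injective endomorphism of the graph is
a translation or a reflection of ℤ, hence moves |k| by a bounded amount, so no graph of the class is
below two of these refinements (`FarApart.not_below`). Strict descent, the absence of antichain
bases and the size of bases all follow. -/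

theorem odd_add_iff (n k : ℤ) : Odd (n + k) ↔ (Odd n ↔ ¬ Odd k) := by
  rw [Int.odd_add, Int.not_odd_iff_even]

theorem decide_odd_add_one (n : ℤ) : decide (Odd (n + 1)) = !decide (Odd n) := by
  by_cases hn : Odd n <;> simp [← Int.not_odd_iff_even, hn]

theorem betaSeq_apply (n : ℤ) : betaSeq n = (decide (Odd n) ^^ decide (0 ≤ n)) := by
  by_cases h : n < 0
  · simp [betaSeq, h, not_le.2 h]
  · by_cases hn : Odd n <;> simp [betaSeq, h, hn, ← Int.not_odd_iff_even, not_lt.1 h]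

/-- The isolated points `σ^k(β₀)` of `K₀`. -/
def betaPt (k : ℤ) : K0 := ⟨fun n => betaSeq (n + k), Or.inr ⟨k, rfl⟩⟩

/-- The two limit points of `K₀`: `α₀` for `false` and `σ(α₀)` for `true`. -/
def alphaPt (i : Bool) : K0 :=
  ⟨fun n => alphaSeq n ^^ i, Or.inl ⟨if i then 1 else 0, by
    funext n
    cases i
    · simp
    · rw [if_pos rfl, alphaSeq, alphaSeq, decide_odd_add_one, Bool.xor_true]⟩⟩

theorem betaPt_apply (k n : ℤ) : (betaPt k).1 n = betaSeq (n + k) := rfl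

theorem alphaPt_apply (i : Bool) (n : ℤ) : (alphaPt i).1 n = (decide (Odd n) ^^ i) := rfl

/-- Source of the condition `side` on filters: σ^k(β₀) is close to α₀ when k is odd and very
positive, or even and very negative. -/
theorem betaPt_eq_alphaPt_apply_iff (k n : ℤ) :
    (betaPt k).1 n = (alphaPt false).1 n ↔ (Odd k ↔ -n ≤ k) := by
  have h : 0 ≤ n + k ↔ -n ≤ k := by omega
  rw [betaPt_apply, alphaPt_apply, betaSeq_apply]
  by_cases hn : Odd n <;> by_cases hk : Odd k <;> by_cases hnk : -n ≤ k <;>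
    simp [h, hnk, hn, hk, odd_add_iff]

/-- A defect is a place where two consecutive letters agree. β₀ has only one, at -1, and the shift
moves it; the points of the two-cycle have none. The defect thus identifies the point, and being a
local condition it isolates it. -/
theorem betaPt_defect_iff (k n : ℤ) : (betaPt k).1 n = (betaPt k).1 (n + 1) ↔ n = -1 - k := by
  have h1 := betaPt_eq_alphaPt_apply_iff k n
  have h2 := betaPt_eq_alphaPt_apply_iff k (n + 1)
  have h3 : (alphaPt false).1 (n + 1) = !(alphaPt false).1 n := by
    rw [alphaPt_apply, alphaPt_apply, decide_odd_add_one, Bool.xor_false, Bool.xor_false]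
  rw [h3] at h2
  have key : (betaPt k).1 n = (betaPt k).1 (n + 1) ↔
      ¬ ((Odd k ↔ -n ≤ k) ↔ (Odd k ↔ -(n + 1) ≤ k)) := by
    rw [← h1, ← h2]
    generalize (betaPt k).1 n = p
    generalize (betaPt k).1 (n + 1) = q
    generalize (alphaPt false).1 n = r
    revert p q r
    decide
  rw [key]
  by_cases hk : Odd k <;> simp only [hk, true_iff, false_iff] <;> omega

theorem alphaPt_no_defect (i : Bool) (n : ℤ) : (alphaPt i).1 n ≠ (alphaPt i).1 (n + 1) := by
  rw [alphaPt_apply, alphaPt_apply, decide_odd_add_one]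
  cases i <;> simp

theorem betaPt_injective : Function.Injective betaPt := by
  intro k l h
  have h1 := (betaPt_defect_iff k (-1 - k)).2 rfl
  rw [h, betaPt_defect_iff] at h1
  omega

theorem alphaPt_injective : Function.Injective alphaPt := by
  intro i j h
  have := congrFun (congrArg Subtype.val h) 0
  simpa [alphaPt_apply] using this

theorem betaPt_ne_alphaPt (k : ℤ) (i : Bool) : betaPt k ≠ alphaPt i := by
  intro h
  have h1 := (betaPt_defect_iff k (-1 - k)).2 rfl
  rw [h] at h1
  exact alphaPt_no_defect i _ h1

theorem K0_cases (x : K0) : (∃ k, x = betaPt k) ∨ ∃ i, x = alphaPt i := by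
  rcases x with ⟨x, ⟨k, hk⟩ | ⟨k, hk⟩⟩
  · refine Or.inr ⟨decide (Odd k), Subtype.ext ?_⟩
    refine hk.trans (funext fun n => ?_)
    rw [alphaPt_apply]
    by_cases hn : Odd n <;> by_cases hk : Odd k <;> simp [alphaSeq, hn, hk, odd_add_iff]
  · exact Or.inl ⟨k, Subtype.ext hk⟩

theorem h0_betaPt (k : ℤ) : h0 (betaPt k) = betaPt (k + 1) := by
  refine Subtype.ext (funext fun n => ?_)
  show betaSeq (n + 1 + k) = betaSeq (n + (k + 1))
  congr 1
  ring

theorem h0_alphaPt (i : Bool) : h0 (alphaPt i) = alphaPt (!i) := by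
  refine Subtype.ext (funext fun n => ?_)
  show (decide (Odd (n + 1)) ^^ i) = (decide (Odd n) ^^ !i)
  rw [decide_odd_add_one]
  cases i <;> simp

theorem h0_symm_betaPt (k : ℤ) : h0.symm (betaPt k) = betaPt (k - 1) := by
  rw [Homeomorph.symm_apply_eq, h0_betaPt, sub_add_cancel]

theorem h0_symm_alphaPt (i : Bool) : h0.symm (alphaPt i) = alphaPt (!i) := by
  rw [Homeomorph.symm_apply_eq, h0_alphaPt, Bool.not_not]

theorem h0_ne (x : K0) : h0 x ≠ x := by
  rcases K0_cases x with ⟨k, rfl⟩ | ⟨i, rfl⟩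
  · rw [h0_betaPt]
    intro h
    have := betaPt_injective h
    omega
  · rw [h0_alphaPt]
    intro h
    have := alphaPt_injective h
    cases i <;> simp at this

/-! ### Adjacency -/

theorem inducedGraph_adj {X : Type u} (f : X → X) (x y : X) :
    (inducedGraph f).Adj x y ↔ x ≠ y ∧ (f x = y ∨ f y = x) := by
  simp [inducedGraph, SimpleGraph.fromRel_adj]

theorem h0_adj (x y : K0) : (inducedGraph h0).Adj x y ↔ h0 x = y ∨ h0 y = x := by
  rw [inducedGraph_adj]
  constructor
  · exact fun h => h.2
  · rintro h
    refine ⟨?_, h⟩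
    rintro rfl
    exact h0_ne x (h.elim id id)

theorem h0_adj_betaPt (k : ℤ) (y : K0) :
    (inducedGraph h0).Adj (betaPt k) y ↔ y = betaPt (k + 1) ∨ y = betaPt (k - 1) := by
  rw [h0_adj, h0_betaPt, ← Homeomorph.eq_symm_apply, h0_symm_betaPt, eq_comm]

theorem h0_adj_alphaPt (i : Bool) (y : K0) :
    (inducedGraph h0).Adj (alphaPt i) y ↔ y = alphaPt (!i) := by
  rw [h0_adj, h0_alphaPt, ← Homeomorph.eq_symm_apply, h0_symm_alphaPt, eq_comm, or_self]

/-! ### The topology of `K₀` -/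

theorem continuous_coord (n : ℤ) : Continuous fun x : K0 => x.1 n :=
  (continuous_apply n).comp continuous_subtype_val

theorem isClopen_coord (n : ℤ) (v : Bool) : IsClopen {x : K0 | x.1 n = v} :=
  (isClopen_discrete {v}).preimage (continuous_coord n)

theorem isOpen_singleton_betaPt (k : ℤ) : IsOpen ({betaPt k} : Set K0) := by
  have : ({betaPt k} : Set K0) = {x : K0 | x.1 (-1 - k) = x.1 (-1 - k + 1)} := by
    ext x
    simp only [mem_singleton_iff, mem_ofPred_eq]
    constructor
    · rintro rfl
      exact (betaPt_defect_iff k _).2 rfl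
    · intro h
      rcases K0_cases x with ⟨l, rfl⟩ | ⟨i, rfl⟩
      · rw [betaPt_defect_iff] at h
        congr 1
        omega
      · exact absurd h (alphaPt_no_defect i _)
  rw [this]
  exact (isOpen_discrete {p : Bool × Bool | p.1 = p.2}).preimage
    ((continuous_coord _).prodMk (continuous_coord _))

theorem K0_countable : K0.Countable := by
  refine Set.Countable.union ?_ ?_
  · exact (countable_range fun k : ℤ => fun n => alphaSeq (n + k)).mono
      (by rintro _ ⟨k, rfl⟩; exact ⟨k, rfl⟩)
  · exact (countable_range fun k : ℤ => fun n => betaSeq (n + k)).mono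
      (by rintro _ ⟨k, rfl⟩; exact ⟨k, rfl⟩)

instance : Countable K0 := K0_countable.to_subtype

theorem image_shift_K0 : shift '' K0 = K0 := by
  ext x
  constructor
  · rintro ⟨y, hy, rfl⟩
    exact (h0 ⟨y, hy⟩).2
  · intro hx
    exact ⟨h0.symm ⟨x, hx⟩, (h0.symm ⟨x, hx⟩).2, congrArg Subtype.val (h0.apply_symm_apply ⟨x, hx⟩)⟩

theorem eq_of_alternating_iff {x y : ℤ → Bool} (h : ∀ n, x n = x (n + 1) ↔ y n = y (n + 1))
    (m : ℤ) (hm : x m = y m) : x = y := by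
  funext n
  induction n using Int.inductionOn' (b := m) with
  | zero => exact hm
  | succ k _ ih =>
    have := h k
    rw [ih] at this
    revert this
    generalize y k = p
    generalize x (k + 1) = q
    generalize y (k + 1) = r
    revert p q r
    decide
  | pred k _ ih =>
    have := h (k - 1)
    rw [sub_add_cancel, ih] at this
    revert this
    generalize y k = p
    generalize x (k - 1) = q
    generalize y (k - 1) = r
    revert p q r
    decide

theorem isClosed_K0 : IsClosed K0 := by
  -- At most one defect, and the repeated letter is 1: each condition involves finitely many
  -- coordinates, hence is closed.
  have : K0 = {x | (∀ n, x n = x (n + 1) → x n = true) ∧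
      ∀ n m, x n = x (n + 1) → x m = x (m + 1) → n = m} := by
    ext x
    constructor
    · intro hx
      rcases K0_cases ⟨x, hx⟩ with ⟨k, hk⟩ | ⟨i, hi⟩
      · obtain rfl : x = (betaPt k).1 := congrArg Subtype.val hk
        refine ⟨fun n hn => ?_, fun n m hn hm => ?_⟩
        · rw [betaPt_defect_iff] at hn
          subst hn
          simp [betaPt, betaSeq]
        · rw [betaPt_defect_iff] at hn hm
          omega
      · obtain rfl : x = (alphaPt i).1 := congrArg Subtype.val hi
        exact ⟨fun n hn => absurd hn (alphaPt_no_defect i n),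
          fun n m hn => absurd hn (alphaPt_no_defect i n)⟩
    · rintro ⟨h1, h2⟩
      by_cases h : ∃ n, x n = x (n + 1)
      · obtain ⟨n, hn⟩ := h
        have : x = (betaPt (-1 - n)).1 := by
          refine eq_of_alternating_iff (fun m => ?_) n ?_
          · rw [betaPt_defect_iff]
            constructor
            · intro hm
              have := h2 n m hn hm
              omega
            · intro hm
              obtain rfl : m = n := by omega
              exact hn
          · rw [h1 n hn]
            simp [betaPt, betaSeq]
        rw [this]
        exact (betaPt _).2
      · push Not at h
        have : x = (alphaPt (x 0)).1 := by
          refine eq_of_alternating_iff (fun m => ?_) 0 ?_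
          · exact iff_of_false (h m) (alphaPt_no_defect _ m)
          · simp [alphaPt_apply]
        rw [this]
        exact (alphaPt _).2
  rw [this]
  have hcl (n : ℤ) (p : Bool × Bool → Prop) : IsClosed {x : ℤ → Bool | p (x n, x (n + 1))} :=
    (isClosed_discrete {q | p q}).preimage
      (by fun_prop : Continuous fun x : ℤ → Bool => (x n, x (n + 1)))
  have hcl2 (n m : ℤ) (p : (Bool × Bool) × Bool × Bool → Prop) :
      IsClosed {x : ℤ → Bool | p ((x n, x (n + 1)), x m, x (m + 1))} :=
    (isClosed_discrete {q | p q}).preimage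
      (by fun_prop : Continuous fun x : ℤ → Bool => ((x n, x (n + 1)), x m, x (m + 1)))
  simp only [ofPred_and, ofPred_forall]
  refine IsClosed.inter (isClosed_iInter fun n => hcl n fun q => q.1 = q.2 → q.1 = true)
    (isClosed_iInter fun n => isClosed_iInter fun m => ?_)
  have := hcl2 n m fun q => q.1.1 = q.1.2 → q.2.1 = q.2.2 → n = m
  simpa only [ofPred_forall] using this

instance : CompactSpace K0 := isCompact_iff_compactSpace.1 isClosed_K0.isCompact

theorem is0DMC_K0 : Is0DMC K0 :=
  ⟨loc_compact_Haus_tot_disc_of_zero_dim, inferInstance, inferInstance⟩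

/-! ### Continuous colorings and the continuous chromatic number -/

theorem TopGraph.HasContColoring.of_injective {Γ : TopGraph.{u}} {C : Type*} {D : Type*}
    (h : Γ.HasContColoring C) {g : C → D} (hg : Function.Injective g) : Γ.HasContColoring D := by
  obtain ⟨c, hc, hadj⟩ := h
  exact ⟨g ∘ c, hc.comp g, fun x y hxy hcxy => hadj x y hxy (hg hcxy)⟩

theorem TopGraph.HasContColoring.out_iff {Γ : TopGraph.{u}} {C : Type} :
    Γ.HasContColoring (#C).out ↔ Γ.HasContColoring C := by
  obtain ⟨e⟩ := Cardinal.eq.1 (Cardinal.mk_out #C)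
  exact ⟨fun h => h.of_injective e.injective, fun h => h.of_injective e.symm.injective⟩

theorem TopGraph.ccn_le {Γ : TopGraph.{u}} {C : Type} (hC : #C ≤ ℵ₀) (h : Γ.HasContColoring C) :
    Γ.ccn ≤ #C :=
  csInf_le' (Or.inl ⟨hC, TopGraph.HasContColoring.out_iff.2 h⟩)

/-- Fewer than three colors inject into `Bool`, and the default value `𝔠` is harmless since it is at
least three. -/
theorem TopGraph.three_le_ccn_iff (Γ : TopGraph.{u}) :
    3 ≤ Γ.ccn ↔ ¬ Γ.HasContColoring Bool := by
  constructor
  · intro h hc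
    have h2 := h.trans (TopGraph.ccn_le (Cardinal.mk_le_aleph0) hc)
    rw [Cardinal.mk_bool] at h2
    exact absurd h2 (by norm_num)
  · intro h
    refine le_csInf ⟨_, Or.inr rfl⟩ ?_
    rintro κ (⟨_, hκ⟩ | hκ)
    · by_contra hlt
      have hle : κ ≤ 2 := by
        have : κ < Order.succ 2 := by
          have h3 : (3 : Cardinal.{0}) = Order.succ ((2 : ℕ) : Cardinal.{0}) := by
            rw [Cardinal.succ_natCast]
            norm_num
          exact h3 ▸ not_le.1 hlt
        exact Order.lt_succ_iff.1 this
      have hle' : #κ.out ≤ #Bool := by rwa [Cardinal.mk_out, Cardinal.mk_bool]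
      obtain ⟨e⟩ := hle'
      exact h (hκ.of_injective e.injective)
    · rw [mem_singleton_iff.1 hκ]
      exact (Cardinal.nat_lt_continuum 3).le

theorem TopGraph.two_lt_ccn_iff (Γ : TopGraph.{u}) :
    2 < Γ.ccn ↔ ¬ Γ.HasContColoring Bool := by
  constructor
  · intro h hc
    have h2 := h.trans_le (TopGraph.ccn_le (Cardinal.mk_le_aleph0) hc)
    rw [Cardinal.mk_bool] at h2
    exact absurd h2 (lt_irrefl _)
  · intro h
    exact lt_of_lt_of_le (by norm_num) (Γ.three_le_ccn_iff.2 h)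

theorem TopGraph.ccn_eq_three {Γ : TopGraph.{u}} (h2 : ¬ Γ.HasContColoring Bool)
    (h3 : Γ.HasContColoring (Fin 3)) : Γ.ccn = 3 := by
  refine le_antisymm ?_ (Γ.three_le_ccn_iff.2 h2)
  have := TopGraph.ccn_le (Cardinal.mk_le_aleph0) h3
  simpa using this

theorem TopGraph.Below.trans {Γ : TopGraph.{u}} {Δ : TopGraph.{v}} {Θ : TopGraph}
    (h1 : Γ.Below Δ) (h2 : Δ.Below Θ) : Γ.Below Θ := by
  obtain ⟨φ, hφ, hφi, hφa⟩ := h1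
  obtain ⟨ψ, hψ, hψi, hψa⟩ := h2
  exact ⟨ψ ∘ φ, hψ.comp hφ, hψi.comp hφi, fun x y h => hψa _ _ (hφa x y h)⟩

theorem TopGraph.Below.hasContColoring {Γ : TopGraph.{u}} {Δ : TopGraph.{v}} {C : Type*}
    (h : Γ.Below Δ) (hc : Δ.HasContColoring C) : Γ.HasContColoring C := by
  obtain ⟨φ, hφ, _, hφa⟩ := h
  obtain ⟨c, hc, hca⟩ := hc
  exact ⟨c ∘ φ, hc.comp_continuous hφ, fun x y h => hca _ _ (hφa x y h)⟩

theorem graphOf_below_of_le {X : Type u} {s t : TopologicalSpace X} (hst : s ≤ t) (f : X → X) :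
    (graphOf s f).Below (graphOf t f) :=
  ⟨id, continuous_id_iff_le.2 hst, Function.injective_id, fun _ _ h => h⟩

/-! ### Zero-dimensional Polish spaces from sequences of locally constant maps -/

theorem clopenBasis_iff {X : Type u} [TopologicalSpace X] :
    ClopenBasis X ↔ ∀ x : X, ∀ U ∈ 𝓝 x, ∃ V, IsClopen V ∧ x ∈ V ∧ V ⊆ U := by
  constructor
  · intro h x U hU
    obtain ⟨V, hV, hx, hVU⟩ := h.mem_nhds_iff.1 hU
    exact ⟨V, hV, hx, hVU⟩
  · intro h
    refine TopologicalSpace.isTopologicalBasis_of_isOpen_of_nhds (fun s hs => hs.isOpen) ?_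
    intro x U hx hU
    obtain ⟨V, hV, hxV, hVU⟩ := h x U (hU.mem_nhds hx)
    exact ⟨V, hV, hxV, hVU⟩

theorem ClopenBasis.of_isInducing {X : Type u} {Y : Type v} [TopologicalSpace X]
    [TopologicalSpace Y] {f : X → Y} (hf : IsInducing f) (hY : ClopenBasis Y) : ClopenBasis X := by
  rw [clopenBasis_iff] at hY ⊢
  intro x U hU
  rw [hf.nhds_eq_comap, mem_comap] at hU
  obtain ⟨W, hW, hWU⟩ := hU
  obtain ⟨V, hV, hxV, hVW⟩ := hY (f x) W hW
  exact ⟨f ⁻¹' V, hV.preimage hf.continuous, hxV, (preimage_mono hVW).trans hWU⟩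

theorem Is0DP.is0DMS {X : Type u} [TopologicalSpace X] (h : Is0DP X) : Is0DMS X := by
  have := h.2
  exact ⟨h.1, inferInstance, inferInstance⟩

theorem Is0DP.of_isClosedEmbedding {X : Type u} {Y : Type v} [TopologicalSpace X]
    [TopologicalSpace Y] {f : X → Y} (hf : IsClosedEmbedding f) (hY : Is0DP Y) : Is0DP X := by
  have := hY.2
  exact ⟨hY.1.of_isInducing hf.isInducing, hf.polishSpace⟩

/-- The maps `r n` together embed `X` into the Polish space `ℕ → D`, with `D` discrete: `hnhds`
makes the map inducing, and `hlim` makes its range closed. -/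
theorem is0DP_of_locallyConstant {X : Type u} [TopologicalSpace X] [T0Space X] {D : Type v} [Countable D]
    (r : ℕ → X → D) (hr : ∀ n, IsLocallyConstant (r n))
    (hnhds : ∀ x, ∀ U ∈ 𝓝 x, ∃ n, {y | r n y = r n x} ⊆ U)
    (hlim : ∀ y : ℕ → D, (∀ N, ∃ x, ∀ n ≤ N, r n x = y n) → ∃ x, ∀ n, r n x = y n) :
    Is0DP X := by
  refine ⟨?_, ?_⟩
  · rw [clopenBasis_iff]
    intro x U hU
    obtain ⟨n, hn⟩ := hnhds x U hU
    exact ⟨{y | r n y = r n x}, (hr n).isClopen_fiber _, rfl, hn⟩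
  · let _ : TopologicalSpace D := ⊥
    have _ : DiscreteTopology D := ⟨rfl⟩
    have _ : PolishSpace D := inferInstance
    have _ : PolishSpace (ℕ → D) := inferInstance
    let Φ : X → ℕ → D := fun x n => r n x
    have hcont : Continuous Φ := by
      refine continuous_pi fun n => ?_
      exact (hr n).continuous
    have hind : IsInducing Φ := by
      rw [isInducing_iff_nhds]
      intro x
      refine le_antisymm (hcont.tendsto x).le_comap ?_
      intro U hU
      obtain ⟨n, hn⟩ := hnhds x U hU
      refine mem_comap.2 ⟨{z | z n = r n x}, ?_, hn⟩
      exact ((isOpen_discrete {r n x}).preimage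
        (continuous_apply (A := fun _ : ℕ => D) n)).mem_nhds rfl
    have hclosed : IsClosed (range Φ) := by
      rw [← closure_subset_iff_isClosed]
      intro y hy
      have : ∀ N, ∃ x, ∀ n ≤ N, r n x = y n := by
        intro N
        have hopen : IsOpen {z : ℕ → D | ∀ n ≤ N, z n = y n} := by
          have : {z : ℕ → D | ∀ n ≤ N, z n = y n} = ⋂ n ∈ Iic N, {z | z n = y n} := by
            ext z
            simp
          rw [this]
          exact (finite_Iic N).isOpen_biInter fun n _ => (isOpen_discrete {y n}).preimage
            (continuous_apply (A := fun _ : ℕ => D) n)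
        obtain ⟨_, hz, x, rfl⟩ := mem_closure_iff.1 hy _ hopen fun n _ => rfl
        exact ⟨x, hz⟩
      obtain ⟨x, hx⟩ := hlim y this
      exact ⟨x, funext hx⟩
    exact IsClosedEmbedding.polishSpace (f := Φ) ⟨hind.isEmbedding, hclosed⟩

/-! ### Colorings of `K₀` -/

theorem mem_nhds_of_isOpen {X : Type u} {τ : TopologicalSpace X} {U : Set X} {x : X}
    (hU : IsOpen[τ] U) (hx : x ∈ U) : U ∈ @nhds X τ x :=
  hU.mem_nhds hx

theorem hasContColoring_graphOf_h0_iff {τ : TopologicalSpace K0} {C : Type*} :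
    (graphOf τ h0).HasContColoring C ↔
      ∃ c : K0 → C, @IsLocallyConstant K0 C τ c ∧ ∀ x, c x ≠ c (h0 x) := by
  constructor
  · rintro ⟨c, hc, h⟩
    exact ⟨c, hc, fun x => h _ _ ((h0_adj x (h0 x)).2 (Or.inl rfl))⟩
  · rintro ⟨c, hc, h⟩
    refine ⟨c, hc, fun x y hxy => ?_⟩
    rcases (h0_adj x y).1 hxy with hx | hy
    · exact hx ▸ h x
    · exact hy ▸ (h y).symm

theorem hasContColoring_three_K0Graph : K0Graph.HasContColoring (Fin 3) := by
  -- Color 2 signals a defect at -1; otherwise the color is the letter at 0. Two consecutive points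
  -- cannot both have their defect at -1, and without defects the letters alternate.
  let g : Bool × Bool → Fin 3 := fun p => if p.1 = p.2 then 2 else if p.2 then 1 else 0
  have hg : ∀ p q r : Bool, ¬ (p = q ∧ q = r) → g (p, q) ≠ g (q, r) := by decide
  have hc : Continuous fun x : K0 => (x.1 (-1), x.1 0) :=
    (continuous_coord _).prodMk (continuous_coord _)
  refine hasContColoring_graphOf_h0_iff.2 ⟨fun x : K0 => g (x.1 (-1), x.1 0),
    (IsLocallyConstant.of_discrete g).comp_continuous hc, fun x => ?_⟩
  refine hg _ _ _ ?_
  rintro ⟨h1, h2⟩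
  rcases K0_cases x with ⟨k, rfl⟩ | ⟨i, rfl⟩
  · have h3 := (betaPt_defect_iff k (-1)).1 h1
    have h4 := (betaPt_defect_iff k 0).1 h2
    omega
  · exact alphaPt_no_defect i (-1) h1

/-- A two-coloring along the orbit of `β₀` is determined by the parity. -/
theorem eq_xor_odd {c : ℤ → Bool} (hc : ∀ k, c k ≠ c (k + 1)) (k : ℤ) :
    c k = (c 0 ^^ decide (Odd k)) := by
  induction k using Int.inductionOn' (b := 0) with
  | zero => simp
  | succ k _ ih =>
    rw [decide_odd_add_one, Bool.xor_not, ← ih]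
    exact (Bool.eq_not_of_ne (hc k).symm)
  | pred k _ ih =>
    have h1 := hc (k - 1)
    have h2 := decide_odd_add_one (k - 1)
    rw [sub_add_cancel] at h1 h2
    rw [h2] at ih
    rw [Bool.eq_not_of_ne h1, ih]
    simp

/-! ### Topologies on `K₀` given by a filter on `ℤ` -/

/-- The filters on `ℤ` which are the traces, along `k ↦ σ^k(β₀)`, of the neighborhoods of `α₀` in a
topology on `K₀` for which `h₀` is a homeomorphism and there is no continuous two-coloring. -/
structure IsLimitFilter (F : Filter ℤ) : Prop where
  side : ∀ m : ℤ, ∀ᶠ k in F, (Odd k ↔ m ≤ k)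
  add_two : Tendsto (fun k : ℤ => k + 2) F F
  sub_two : Tendsto (fun k : ℤ => k - 2) F F
  odd : ∃ᶠ k in F, Odd k
  even : ∃ᶠ k in F, ¬ Odd k

/-- The topology on `K₀` for which the points of the orbit of `β₀` are isolated, and the
neighborhoods of the two other points are given by the filter `F`. -/
@[reducible]
def limitTop (F : Filter ℤ) : TopologicalSpace K0 where
  IsOpen U := (alphaPt false ∈ U → ∀ᶠ k in F, betaPt k ∈ U) ∧
    -- The neighborhoods of σ(α₀) are forced to be the images under `h0` of those of α₀, whence the
    -- index `k + 1`.
    (alphaPt true ∈ U → ∀ᶠ k in F, betaPt (k + 1) ∈ U)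
  isOpen_univ := by simp
  isOpen_inter U V hU hV :=
    ⟨fun h => (hU.1 h.1).and (hV.1 h.2), fun h => (hU.2 h.1).and (hV.2 h.2)⟩
  isOpen_sUnion S hS := by
    refine ⟨?_, ?_⟩
    · rintro ⟨U, hU, h⟩
      exact ((hS U hU).1 h).mono fun k hk => ⟨U, hU, hk⟩
    · rintro ⟨U, hU, h⟩
      exact ((hS U hU).2 h).mono fun k hk => ⟨U, hU, hk⟩

theorem isOpen_limitTop {F : Filter ℤ} {U : Set K0} :
    IsOpen[limitTop F] U ↔ (alphaPt false ∈ U → ∀ᶠ k in F, betaPt k ∈ U) ∧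
      (alphaPt true ∈ U → ∀ᶠ k in F, betaPt (k + 1) ∈ U) := Iff.rfl

/-- Convergence at α₀ suffices, since continuity of `h0` transports it to σ(α₀). -/
theorem limitTop_le {F : Filter ℤ} {τ : TopologicalSpace K0} (hτ : @Continuous K0 K0 τ τ h0)
    (hF : Tendsto betaPt F (@nhds K0 τ (alphaPt false))) : limitTop F ≤ τ := by
  intro U hU
  have key : ∀ V : Set K0, IsOpen[τ] V → alphaPt false ∈ V → ∀ᶠ k in F, betaPt k ∈ V :=
    fun V hV h => hF.eventually (hV.mem_nhds h)
  refine ⟨key U hU, fun h => ?_⟩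
  have := key (h0 ⁻¹' U) (hU.preimage hτ) (by rwa [mem_preimage, h0_alphaPt])
  simpa only [mem_preimage, h0_betaPt] using this

theorem tendsto_betaPt_nhds {F : Filter ℤ} (hF : ∀ m : ℤ, ∀ᶠ k in F, (Odd k ↔ m ≤ k)) :
    Tendsto betaPt F (𝓝 (alphaPt false)) := by
  rw [tendsto_subtype_rng, tendsto_pi_nhds]
  intro n
  refine tendsto_nhds_of_eventually_eq ?_
  filter_upwards [hF (-n)] with k hk
  exact (betaPt_eq_alphaPt_apply_iff k n).2 hk

theorem IsLimitFilter.limitTop_le_K0Top {F : Filter ℤ} (hF : IsLimitFilter F) :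
    limitTop F ≤ K0Top :=
  limitTop_le h0.continuous (tendsto_betaPt_nhds hF.side)

/-- The passage from α₀ to σ(α₀) is built into `limitTop`; the return to α₀ closes the two-cycle and
moves the index by 2, which is where `add_two` is needed. The inverse uses `sub_two` in the same
way. -/
theorem IsLimitFilter.continuous_h0 {F : Filter ℤ} (hF : IsLimitFilter F) :
    @Continuous K0 K0 (limitTop F) (limitTop F) h0 := by
  refine @Continuous.mk _ _ (limitTop F) (limitTop F) _ fun U hU => ⟨fun h => ?_, fun h => ?_⟩
  · rw [mem_preimage, h0_alphaPt] at h
    simpa only [mem_preimage, h0_betaPt] using hU.2 h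
  · rw [mem_preimage, h0_alphaPt] at h
    have := hF.add_two.eventually (hU.1 h)
    refine this.mono fun k hk => ?_
    rwa [mem_preimage, h0_betaPt, add_assoc]

theorem IsLimitFilter.continuous_h0Inv {F : Filter ℤ} (hF : IsLimitFilter F) :
    @Continuous K0 K0 (limitTop F) (limitTop F) h0Inv := by
  refine @Continuous.mk _ _ (limitTop F) (limitTop F) _ fun U hU => ⟨fun h => ?_, fun h => ?_⟩
  · rw [h0Inv, mem_preimage, h0_symm_alphaPt] at h
    have := hF.sub_two.eventually (hU.2 h)
    refine this.mono fun k hk => ?_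
    rw [h0Inv, mem_preimage, h0_symm_betaPt]
    convert hk using 2
    ring
  · rw [h0Inv, mem_preimage, h0_symm_alphaPt] at h
    refine (hU.1 h).mono fun k hk => ?_
    rwa [h0Inv, mem_preimage, h0_symm_betaPt, add_sub_cancel_right]

/-- The color of σ^k(β₀) is the parity of k up to a constant, while continuity at α₀ makes it
constant along `F`, which meets both parities. -/
theorem IsLimitFilter.not_hasContColoring {F : Filter ℤ} (hF : IsLimitFilter F) :
    ¬ (graphOf (limitTop F) h0).HasContColoring Bool := by
  rw [hasContColoring_graphOf_h0_iff]
  rintro ⟨c, hc, hadj⟩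
  have hodd := eq_xor_odd (c := fun k => c (betaPt k)) fun k => by
    simpa only [h0_betaPt] using hadj (betaPt k)
  have hev : ∀ᶠ k in F, c (betaPt k) = c (alphaPt false) :=
    (isOpen_limitTop.1 (hc {c (alphaPt false)})).1 rfl
  obtain ⟨k, hk, hko⟩ := (hF.odd.and_eventually hev).exists
  obtain ⟨l, hl, hle⟩ := (hF.even.and_eventually hev).exists
  have := hko.trans hle.symm
  rw [hodd k, hodd l, decide_eq_true hk, decide_eq_false hl] at this
  simp at this

theorem hasContColoring_three_of_le {τ : TopologicalSpace K0} (hτ : τ ≤ K0Top) :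
    (graphOf τ h0).HasContColoring (Fin 3) :=
  (graphOf_below_of_le hτ h0).hasContColoring hasContColoring_three_K0Graph

theorem isRefinement_iff {τ : TopologicalSpace K0} : IsRefinement τ ↔
    τ ≤ K0Top ∧ @Continuous K0 K0 τ τ h0 ∧ @Continuous K0 K0 τ τ h0Inv ∧
      ¬ (graphOf τ h0).HasContColoring Bool := by
  constructor
  · rintro ⟨h1, h2, h3, h4⟩
    exact ⟨h1, h2, h3, (TopGraph.three_le_ccn_iff _).1 h4.ge⟩
  · rintro ⟨h1, h2, h3, h4⟩
    exact ⟨h1, h2, h3, TopGraph.ccn_eq_three h4 (hasContColoring_three_of_le h1)⟩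

theorem IsLimitFilter.isRefinement {F : Filter ℤ} (hF : IsLimitFilter F) :
    IsRefinement (limitTop F) :=
  isRefinement_iff.2 ⟨hF.limitTop_le_K0Top, hF.continuous_h0, hF.continuous_h0Inv,
    hF.not_hasContColoring⟩

/-- The trace on the orbit of `β₀` of the neighborhoods of `α₀`. -/
def traceFilter (τ : TopologicalSpace K0) : Filter ℤ := comap betaPt (@nhds K0 τ (alphaPt false))

theorem traceFilter_limitTop_le (F : Filter ℤ) : traceFilter (limitTop F) ≤ F := by
  intro E hE
  -- This set is open because it avoids σ(α₀), so that only the condition at α₀ matters.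
  refine mem_comap.2 ⟨insert (alphaPt false) (betaPt '' E), ?_, ?_⟩
  · refine mem_nhds_of_isOpen ?_ (mem_insert _ _)
    refine isOpen_limitTop.2 ⟨fun _ => ?_, fun h => ?_⟩
    · exact mem_of_superset hE fun k hk => Or.inr ⟨k, hk, rfl⟩
    · rcases h with h | ⟨k, -, h⟩
      · exact absurd (alphaPt_injective h) (by simp)
      · exact absurd h (betaPt_ne_alphaPt _ _)
  · rintro k (h | ⟨l, hl, h⟩)
    · exact absurd h (betaPt_ne_alphaPt _ _)
    · rwa [← betaPt_injective h]

theorem isOpen_singleton_betaPt_of_le {τ : TopologicalSpace K0} (hτ : τ ≤ K0Top) (k : ℤ) :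
    IsOpen[τ] {betaPt k} := hτ _ (isOpen_singleton_betaPt k)

theorem isOpen_coord_of_le {τ : TopologicalSpace K0} (hτ : τ ≤ K0Top) (n : ℤ) (v : Bool) :
    IsOpen[τ] {x : K0 | x.1 n = v} := hτ _ (isClopen_coord n v).2

/-- `odd` and `even` come from the chromatic number: if the parity were constant along the trace, it
would extend to a continuous two-coloring. The other conditions come from the finer topology and the
continuity of `h0` and its inverse. -/
theorem IsRefinement.isLimitFilter {τ : TopologicalSpace K0} (hτ : IsRefinement τ) :
    IsLimitFilter (traceFilter τ) := by
  obtain ⟨hle, hc, hci, hcol⟩ := isRefinement_iff.1 hτ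
  have htend : Tendsto betaPt (traceFilter τ) (@nhds K0 τ (alphaPt false)) := tendsto_comap
  have hcol' : ∀ v : Bool, ¬ ∀ᶠ k in traceFilter τ, decide (Odd k) = v := by
    intro v hv
    obtain ⟨W, hW, hWv⟩ := mem_comap.1 hv
    refine hcol ?_
    classical
    let par : K0 → Bool := fun x =>
      if h : ∃ k, x = betaPt k then decide (Odd h.choose)
      else if x = alphaPt false then v else !v
    have hpar_beta (k : ℤ) : par (betaPt k) = decide (Odd k) := by
      have h : ∃ l, betaPt k = betaPt l := ⟨k, rfl⟩
      have h' := betaPt_injective h.choose_spec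
      simp only [par, dif_pos h]
      rw [← h']
    have hpar_alpha (i : Bool) : par (alphaPt i) = (v ^^ i) := by
      have h : ¬ ∃ l, alphaPt i = betaPt l := fun ⟨l, hl⟩ => betaPt_ne_alphaPt l i hl.symm
      simp only [par, dif_neg h]
      cases i
      · simp
      · rw [if_neg fun h => absurd (alphaPt_injective h) (by simp), Bool.xor_true]
    have hpar_h0 (x : K0) : par (h0 x) = !par x := by
      rcases K0_cases x with ⟨k, rfl⟩ | ⟨i, rfl⟩
      · rw [h0_betaPt, hpar_beta, hpar_beta, decide_odd_add_one]
      · rw [h0_alphaPt, hpar_alpha, hpar_alpha, Bool.xor_not]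
    have hfalse : ∀ᶠ x in @nhds K0 τ (alphaPt false), par x = par (alphaPt false) := by
      have hside : {x : K0 | x.1 0 = (alphaPt false).1 0} ∈ @nhds K0 τ (alphaPt false) :=
        mem_nhds_of_isOpen (isOpen_coord_of_le hle 0 _) rfl
      filter_upwards [hW, hside] with x hx hx0
      rcases K0_cases x with ⟨k, rfl⟩ | ⟨i, rfl⟩
      · rw [hpar_beta, hpar_alpha, Bool.xor_false]
        exact hWv hx
      · cases i
        · rfl
        · simp [alphaPt_apply] at hx0
    refine hasContColoring_graphOf_h0_iff.2 ⟨par, ?_, ?_⟩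
    · refine (@IsLocallyConstant.iff_eventually_eq K0 Bool τ par).2 fun x => ?_
      rcases K0_cases x with ⟨k, rfl⟩ | ⟨i, rfl⟩
      · exact mem_of_superset
          (mem_nhds_of_isOpen (isOpen_singleton_betaPt_of_le hle k) rfl)
          fun y hy => congrArg par (mem_singleton_iff.1 hy)
      · cases i
        · exact hfalse
        · have h1 : Tendsto h0 (@nhds K0 τ (alphaPt true)) (@nhds K0 τ (alphaPt false)) :=
            @Continuous.tendsto' K0 K0 τ τ _ hc _ _ (h0_alphaPt true)
          refine (h1.eventually hfalse).mono fun x hx => ?_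
          rw [hpar_h0, hpar_alpha] at hx
          rw [hpar_alpha, Bool.xor_true]
          rw [Bool.xor_false] at hx
          rw [← hx, Bool.not_not]
    · intro x
      rw [hpar_h0]
      simp
  refine ⟨fun m => ?_, ?_, ?_, ?_, ?_⟩
  · have hmem : {x : K0 | x.1 (-m) = (alphaPt false).1 (-m)} ∈ @nhds K0 τ (alphaPt false) :=
      mem_nhds_of_isOpen (isOpen_coord_of_le hle _ _) rfl
    refine (htend.eventually hmem).mono fun k hk => ?_
    simpa using (betaPt_eq_alphaPt_apply_iff k (-m)).1 hk
  · refine tendsto_comap_iff.2 ?_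
    have h1 : Tendsto (fun x => h0 (h0 x)) (@nhds K0 τ (alphaPt false))
        (@nhds K0 τ (alphaPt false)) :=
      @Continuous.tendsto' K0 K0 τ τ _ (@Continuous.comp K0 K0 K0 τ τ τ _ _ hc hc) _ _
        (by simp [h0_alphaPt])
    refine (h1.comp htend).congr fun k => ?_
    simp only [Function.comp_apply, h0_betaPt, add_assoc]
    rfl
  · refine tendsto_comap_iff.2 ?_
    have h1 : Tendsto (fun x => h0Inv (h0Inv x)) (@nhds K0 τ (alphaPt false))
        (@nhds K0 τ (alphaPt false)) :=
      @Continuous.tendsto' K0 K0 τ τ _ (@Continuous.comp K0 K0 K0 τ τ τ _ _ hci hci) _ _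
        (by simp [h0Inv, h0_symm_alphaPt])
    refine (h1.comp htend).congr fun k => ?_
    simp only [Function.comp_apply, h0Inv, h0_symm_betaPt, sub_sub]
    rfl
  · intro h
    exact hcol' false (h.mono fun k hk => decide_eq_false hk)
  · intro h
    exact hcol' true (h.mono fun k hk => decide_eq_true (not_not.1 hk))

theorem IsLimitFilter.eventually_ne {F : Filter ℤ} (hF : IsLimitFilter F) (k : ℤ) :
    ∀ᶠ j in F, j ≠ k := by
  filter_upwards [hF.side k, hF.side (k + 1)] with j h1 h2
  rintro rfl
  simp only [le_refl, iff_true] at h1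
  have := h2.1 h1
  omega

/-- For a decreasing basis `V n`, the map `r n` collapses the points of index in `V n` to α₀, those
of index in `V n + 1` to σ(α₀), and fixes the others. These maps satisfy the criterion
`is0DP_of_locallyConstant`. -/
theorem IsLimitFilter.is0DP {F : Filter ℤ} (hF : IsLimitFilter F) [F.IsCountablyGenerated] :
    @Is0DP K0 (limitTop F) := by
  obtain ⟨W, hW⟩ := F.exists_antitone_basis
  -- The condition `side 0` forbids consecutive integers, so that the two collapsed sets are
  -- disjoint, even for different values of n.
  let V : ℕ → Set ℤ := fun n => W n ∩ {k | Odd k ↔ 0 ≤ k}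
  have hV (n : ℕ) : V n ∈ F := inter_mem (hW.mem n) (hF.side 0)
  have hVmem {E : Set ℤ} (hE : E ∈ F) : ∃ n, V n ⊆ E := by
    obtain ⟨n, hn⟩ := hW.mem_iff.1 hE
    exact ⟨n, inter_subset_left.trans hn⟩
  have hVdisj {m n : ℕ} {k : ℤ} (h : k + 1 ∈ V m) (h' : k ∈ V n) : False := by
    have h1 : Odd (k + 1) ↔ 0 ≤ k + 1 := h.2
    have h2 : Odd k ↔ 0 ≤ k := h'.2
    have h3 : Odd (k + 1) ↔ ¬ Odd k := by simp [← Int.not_odd_iff_even]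
    rw [h3] at h1
    by_cases hk : Odd k
    · have := h2.1 hk
      exact absurd (h1.2 (by omega)) (not_not.2 hk)
    · have h3 := h1.1 hk
      have h4 := mt h2.2 hk
      obtain rfl : k = -1 := by omega
      exact hk (by decide)
  classical
  let r : ℕ → K0 → K0 := fun n x =>
    if x = alphaPt false ∨ ∃ k ∈ V n, x = betaPt k then alphaPt false
    else if x = alphaPt true ∨ ∃ k ∈ V n, x = betaPt (k + 1) then alphaPt true else x
  have r_alpha (n : ℕ) (i : Bool) : r n (alphaPt i) = alphaPt i := by
    have h1 (k : ℤ) : alphaPt i ≠ betaPt k := (betaPt_ne_alphaPt k i).symm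
    cases i
    · simp [r]
    · have h2 : alphaPt true ≠ alphaPt false := fun h => absurd (alphaPt_injective h) (by simp)
      simp [r, h1, h2]
  have r_beta_false {n : ℕ} {k : ℤ} (hk : k ∈ V n) : r n (betaPt k) = alphaPt false :=
    if_pos (Or.inr ⟨k, hk, rfl⟩)
  have r_beta_true {n : ℕ} {k : ℤ} (hk : k ∈ V n) : r n (betaPt (k + 1)) = alphaPt true := by
    have h1 : ¬ (betaPt (k + 1) = alphaPt false ∨ ∃ l ∈ V n, betaPt (k + 1) = betaPt l) := by
      rintro (h | ⟨l, hl, h⟩)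
      · exact betaPt_ne_alphaPt _ _ h
      · rw [← betaPt_injective h] at hl
        exact hVdisj hl hk
    exact (if_neg h1).trans (if_pos (Or.inr ⟨k, hk, rfl⟩))
  have r_eq_false {n : ℕ} {x : K0} (h : r n x = alphaPt false) :
      x = alphaPt false ∨ ∃ k ∈ V n, x = betaPt k := by
    by_contra hx
    simp only [r, if_neg hx] at h
    split_ifs at h with h'
    · exact absurd (alphaPt_injective h) (by simp)
    · exact hx (Or.inl h)
  have r_eq_true {n : ℕ} {x : K0} (h : r n x = alphaPt true) :
      x = alphaPt true ∨ ∃ k ∈ V n, x = betaPt (k + 1) := by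
    by_contra hx
    simp only [r, if_neg hx] at h
    split_ifs at h with h'
    · exact absurd (alphaPt_injective h) (by simp)
    · exact hx (Or.inl h)
  have r_eq_beta {n : ℕ} {x : K0} {k : ℤ} (h : r n x = betaPt k) : x = betaPt k := by
    simp only [r] at h
    split_ifs at h
    · exact absurd h.symm (betaPt_ne_alphaPt _ _)
    · exact absurd h.symm (betaPt_ne_alphaPt _ _)
    · exact h
  let τ := limitTop F
  have hτ : τ ≤ K0Top := hF.limitTop_le_K0Top
  have hT2 : @T2Space K0 τ := @T2Space.of_injective_continuous K0 K0 τ K0Top _ id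
    Function.injective_id (continuous_id_iff_le.2 hτ)
  refine @is0DP_of_locallyConstant K0 τ (@T1Space.t0Space K0 τ (@T2Space.t1Space K0 τ hT2)) K0 _ r
    ?_ ?_ ?_
  · intro n s
    refine isOpen_limitTop.2 ⟨fun h => ?_, fun h => ?_⟩
    · rw [mem_preimage, r_alpha] at h
      filter_upwards [hV n] with k hk
      rwa [mem_preimage, r_beta_false hk]
    · rw [mem_preimage, r_alpha] at h
      filter_upwards [hV n] with k hk
      rwa [mem_preimage, r_beta_true hk]
  · intro x U hU
    obtain ⟨O, hOU, hO, hxO⟩ := (@mem_nhds_iff K0 τ x U).1 hU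
    rcases K0_cases x with ⟨k, rfl⟩ | ⟨i, rfl⟩
    · obtain ⟨n, hn⟩ := hVmem ((hF.eventually_ne k).and (hF.eventually_ne (k - 1)))
      have hrk : r n (betaPt k) = betaPt k := by
        rcases K0_cases (r n (betaPt k)) with ⟨l, hl⟩ | ⟨i, hi⟩
        · rw [hl, ← r_eq_beta hl]
        · exfalso
          cases i
          · rcases r_eq_false hi with h | ⟨l, hl, h⟩
            · exact betaPt_ne_alphaPt _ _ h
            · exact (hn hl).1 (betaPt_injective h).symm
          · rcases r_eq_true hi with h | ⟨l, hl, h⟩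
            · exact betaPt_ne_alphaPt _ _ h
            · exact (hn hl).2 (by have := betaPt_injective h; omega)
      refine ⟨n, fun y hy => ?_⟩
      rw [mem_ofPred_eq, hrk] at hy
      rw [r_eq_beta hy]
      exact hOU hxO
    · cases i
      · obtain ⟨n, hn⟩ := hVmem ((isOpen_limitTop.1 hO).1 hxO)
        refine ⟨n, fun y hy => hOU ?_⟩
        rw [mem_ofPred_eq, r_alpha] at hy
        rcases r_eq_false hy with rfl | ⟨k, hk, rfl⟩
        · exact hxO
        · exact hn hk
      · obtain ⟨n, hn⟩ := hVmem ((isOpen_limitTop.1 hO).2 hxO)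
        refine ⟨n, fun y hy => hOU ?_⟩
        rw [mem_ofPred_eq, r_alpha] at hy
        rcases r_eq_true hy with rfl | ⟨k, hk, rfl⟩
        · exact hxO
        · exact hn hk
  · intro y hy
    -- An isolated value of `y` is its own limit. Otherwise all the values are in the two-cycle, and
    -- they agree since no point is collapsed to both of its elements.
    by_cases h : ∃ n k, y n = betaPt k
    · obtain ⟨n, k, hk⟩ := h
      refine ⟨betaPt k, fun m => ?_⟩
      obtain ⟨x, hx⟩ := hy (max n m)
      have h1 := hx n (le_max_left _ _)
      rw [hk] at h1
      rw [← r_eq_beta h1]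
      exact hx m (le_max_right _ _)
    · have hα (n : ℕ) : ∃ i, y n = alphaPt i := by
        rcases K0_cases (y n) with ⟨k, hk⟩ | h'
        · exact absurd ⟨n, k, hk⟩ h
        · exact h'
      choose i hi using hα
      have hmix {m n : ℕ} {x : K0} (h1 : r m x = alphaPt false) (h2 : r n x = alphaPt true) :
          False := by
        rcases r_eq_false h1 with rfl | ⟨k, hk, rfl⟩
        · rw [r_alpha] at h2
          exact absurd (alphaPt_injective h2) (by simp)
        · rcases r_eq_true h2 with h | ⟨l, hl, h⟩
          · exact betaPt_ne_alphaPt _ _ h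
          · rw [betaPt_injective h] at hk
            exact hVdisj hk hl
      have hconst (n : ℕ) : i n = i 0 := by
        obtain ⟨x, hx⟩ := hy n
        have h1 := hx n le_rfl
        have h2 := hx 0 (Nat.zero_le _)
        rw [hi] at h1 h2
        cases h3 : i n <;> cases h4 : i 0 <;> rw [h3] at h1 <;> rw [h4] at h2
        · exact (hmix h1 h2).elim
        · exact (hmix h2 h1).elim
      exact ⟨alphaPt (i 0), fun n => by rw [r_alpha, hi, hconst n]⟩

/-! ### `K₀` has continuous chromatic number three -/

theorem tendsto_betaPt_two_mul_add_one :
    Tendsto (fun n : ℕ => betaPt (2 * n + 1)) atTop (𝓝 (alphaPt false)) := by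
  refine (tendsto_betaPt_nhds (F := map (fun n : ℕ => 2 * (n : ℤ) + 1) atTop) fun m => ?_).comp
    tendsto_map
  rw [eventually_map]
  filter_upwards [eventually_ge_atTop m.toNat] with n hn
  have h1 : Odd (2 * (n : ℤ) + 1) := ⟨n, rfl⟩
  simp only [h1, true_iff]
  omega

theorem tendsto_betaPt_neg_two_mul :
    Tendsto (fun n : ℕ => betaPt (-(2 * n))) atTop (𝓝 (alphaPt false)) := by
  refine (tendsto_betaPt_nhds (F := map (fun n : ℕ => -(2 * (n : ℤ))) atTop) fun m => ?_).comp
    tendsto_map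
  rw [eventually_map]
  filter_upwards [eventually_gt_atTop (-m).toNat] with n hn
  have h1 : ¬ Odd (-(2 * (n : ℤ))) := by simp
  simp only [h1, false_iff]
  omega

theorem not_hasContColoring_K0Graph : ¬ K0Graph.HasContColoring Bool := by
  intro h
  obtain ⟨c, hc, hadj⟩ := hasContColoring_graphOf_h0_iff.1 h
  have hodd := eq_xor_odd (c := fun k => c (betaPt k)) fun k => by
    simpa only [h0_betaPt] using hadj (betaPt k)
  have hev : ∀ᶠ x in 𝓝 (alphaPt false), c x = c (alphaPt false) :=
    (IsLocallyConstant.iff_eventually_eq c).1 hc _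
  obtain ⟨n, h1, h2⟩ := ((tendsto_betaPt_two_mul_add_one.eventually hev).and
    (tendsto_betaPt_neg_two_mul.eventually hev)).exists
  have h3 : Odd (2 * (n : ℤ) + 1) := ⟨n, rfl⟩
  have h4 : ¬ Odd (-(2 * (n : ℤ))) := by simp
  have := h1.trans h2.symm
  rw [hodd, hodd (-(2 * n)), decide_eq_true h3, decide_eq_false h4] at this
  simp at this

theorem isRefinement_K0Top : IsRefinement K0Top :=
  isRefinement_iff.2 ⟨le_rfl, h0.continuous, h0.symm.continuous, not_hasContColoring_K0Graph⟩

/-! ### Graphs below `K₀` -/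

theorem eq_betaPt_of_defect {x : K0} {n : ℤ} (h : x.1 n = x.1 (n + 1)) : x = betaPt (-1 - n) := by
  rcases K0_cases x with ⟨k, rfl⟩ | ⟨i, rfl⟩
  · rw [betaPt_defect_iff] at h
    congr 1
    omega
  · exact absurd h (alphaPt_no_defect i n)

theorem h0_apply (x : K0) (n : ℤ) : (h0 x).1 n = x.1 (n + 1) := rfl

/-- A graph which is not continuously two-colorable and is mapped to `K₀` covers all the edges of
the orbit of `β₀`. -/
theorem exists_adj_betaPt {Γ : TopGraph.{u}} (hΓ : ¬ Γ.HasContColoring Bool) {φ : Γ.V → K0}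
    (hφ : Continuous φ) (hadj : ∀ x y, Γ.graph.Adj x y → (inducedGraph h0).Adj (φ x) (φ y))
    (k : ℤ) : ∃ x y, φ x = betaPt k ∧ φ y = betaPt (k + 1) ∧ Γ.graph.Adj x y := by
  by_contra hne
  have hdef {x : K0} (h : x.1 (-1 - k) = (h0 x).1 (-1 - k)) : x = betaPt k := by
    rw [h0_apply] at h
    rw [eq_betaPt_of_defect h]
    congr 1
    omega
  -- The coordinate -1 - k changes along all the edges of `K0` except the one joining σ^k(β₀) and
  -- σ^(k+1)(β₀). If that edge is not covered, this coordinate is a continuous two-coloring.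
  refine hΓ ⟨fun x => (φ x).1 (-1 - k), ?_, fun x y hxy (heq : (φ x).1 (-1 - k) = (φ y).1 (-1 - k)) => ?_⟩
  · exact (IsLocallyConstant.iff_continuous _).2 ((continuous_coord _).comp hφ)
  · rcases (h0_adj _ _).1 (hadj x y hxy) with h | h
    · rw [← h] at heq
      have hx := hdef heq
      exact hne ⟨x, y, hx, by rw [← h, hx, h0_betaPt], hxy⟩
    · rw [← h] at heq
      have hy := hdef heq.symm
      exact hne ⟨y, x, hy, by rw [← h, hy, h0_betaPt], hxy.symm⟩

theorem inducedGraph_symm {X : Type u} (f : X ≃ X) :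
    inducedGraph f.symm = inducedGraph f := by
  ext x y
  rw [inducedGraph_adj, inducedGraph_adj, Equiv.symm_apply_eq, Equiv.symm_apply_eq]
  refine and_congr_right fun _ => ?_
  rw [or_comm, @eq_comm _ y, @eq_comm _ x]

/-- By injectivity the homeomorphism cannot change direction along the line `s`; if it goes
backwards, its inverse induces the same graph and goes forwards. -/
theorem exists_homeo_succ {Γ : TopGraph.{u}} (hf : Γ.HomeoInduced)
    (s : ℤ → Γ.V) (hs : Function.Injective s)
    (hs1 : ∀ k, Γ.graph.Adj (s k) (s (k + 1)))
    (hs2 : ∀ k y, Γ.graph.Adj (s k) y → y = s (k + 1) ∨ y = s (k - 1)) :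
    ∃ g : Γ.V ≃ₜ Γ.V, Γ.graph = inducedGraph g ∧ ∀ k, g (s k) = s (k + 1) := by
  obtain ⟨f, hf⟩ := hf
  have hedge (k : ℤ) : f (s k) = s (k + 1) ∨ f (s (k + 1)) = s k := by
    have := hs1 k
    rw [hf, inducedGraph_adj] at this
    exact this.2
  have hstep (k : ℤ) : f (s k) = s (k + 1) ∨ f (s k) = s (k - 1) := by
    refine hs2 k _ ?_
    rw [hf, inducedGraph_adj]
    refine ⟨fun h => ?_, Or.inl rfl⟩
    rcases hedge k with h' | h'
    · have := hs (h.trans h')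
      omega
    · rw [h] at h'
      have := hs (f.injective (h'.trans (by rw [← h])))
      omega
  have hdir (k : ℤ) : f (s k) = s (k + 1) ↔ f (s (k + 1)) = s (k + 1 + 1) := by
    constructor
    · intro h
      refine (hedge (k + 1)).resolve_right fun h' => ?_
      have := hs (f.injective (h.trans h'.symm))
      omega
    · intro h
      refine (hedge k).resolve_right fun h' => ?_
      have := hs (h.symm.trans h')
      omega
  have hall (k : ℤ) : f (s k) = s (k + 1) ↔ f (s 0) = s (0 + 1) := by
    induction k using Int.inductionOn' (b := 0) with
    | zero => rfl
    | succ k _ ih => rw [← hdir, ih]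
    | pred k _ ih => rw [hdir, sub_add_cancel, ih]
  by_cases h0 : f (s 0) = s (0 + 1)
  · exact ⟨f, hf, fun k => (hall k).2 h0⟩
  · refine ⟨f.symm, ?_, fun k => ?_⟩
    · rw [hf]
      exact (inducedGraph_symm f.toEquiv).symm
    · rw [Homeomorph.symm_apply_eq]
      have := (hstep (k + 1)).resolve_left fun h => h0 ((hall _).1 h)
      rw [this, add_sub_cancel_right]

theorem isLocallyConstant_of_isOpen_singleton {X : Type u} [TopologicalSpace X] {C : Type*}
    (h : ∀ x : X, IsOpen {x}) (c : X → C) : IsLocallyConstant c :=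
  (IsLocallyConstant.iff_eventually_eq c).2 fun x =>
    mem_of_superset ((h x).mem_nhds rfl) fun y hy => by rw [mem_singleton_iff.1 hy]; rfl

/-- A graph induced by a homeomorphism, not continuously two-colorable, and injectively mapped to
`K₀`, is conjugate to `h₀` as a dynamical system. -/
theorem exists_conj {Γ : TopGraph.{u}} (hΓ : ¬ Γ.HasContColoring Bool) (hf : Γ.HomeoInduced)
    {φ : Γ.V → K0} (hφ : Continuous φ) (hinj : Function.Injective φ)
    (hadj : ∀ x y, Γ.graph.Adj x y → (inducedGraph h0).Adj (φ x) (φ y)) :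
    ∃ g : Γ.V ≃ₜ Γ.V, Γ.graph = inducedGraph g ∧ Function.Bijective φ ∧
      ∀ x, φ (g x) = h0 (φ x) := by
  have hex (k : ℤ) : ∃ x, φ x = betaPt k := by
    obtain ⟨x, -, hx, -⟩ := exists_adj_betaPt hΓ hφ hadj k
    exact ⟨x, hx⟩
  choose s hs using hex
  have hs_eq {x : Γ.V} {k : ℤ} (h : φ x = betaPt k) : x = s k := hinj (h.trans (hs k).symm)
  have hs_inj : Function.Injective s := fun k l h =>
    betaPt_injective (by rw [← hs, ← hs, h])
  have hs1 (k : ℤ) : Γ.graph.Adj (s k) (s (k + 1)) := by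
    obtain ⟨x, y, hx, hy, hxy⟩ := exists_adj_betaPt hΓ hφ hadj k
    rwa [hs_eq hx, hs_eq hy] at hxy
  have hs2 (k : ℤ) (y : Γ.V) (h : Γ.graph.Adj (s k) y) : y = s (k + 1) ∨ y = s (k - 1) := by
    have := hadj _ _ h
    rw [hs, h0_adj_betaPt] at this
    exact this.imp hs_eq hs_eq
  obtain ⟨g, hg, hgs⟩ := exists_homeo_succ hf s hs_inj hs1 hs2
  have hg_adj {x : Γ.V} (h : g x ≠ x) : Γ.graph.Adj x (g x) := by
    rw [hg, inducedGraph_adj]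
    exact ⟨h.symm, Or.inl rfl⟩
  have hcases (x : Γ.V) : (∃ k, x = s k) ∨ ∃ i, φ x = alphaPt i :=
    (K0_cases (φ x)).imp (fun ⟨k, hk⟩ => ⟨k, hs_eq hk⟩) id
  have hisol {x : Γ.V} {i : Bool} (hx : φ x = alphaPt i) (hgx : g x = x) : IsOpen {x} := by
    have hU (n : ℤ) : IsOpen {y : Γ.V | (φ y).1 n = (alphaPt i).1 n} :=
      (isClopen_coord n _).isOpen.preimage hφ
    -- On the line, coordinate 1 of `φ y` is coordinate 0 of `φ (g y)`. Near a fixed point `x` these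
    -- would be two consecutive letters of `alphaPt i`, which differ; so no point of the line
    -- remains, and coordinate 0 excludes the other point of the two-cycle.
    have : ({x} : Set Γ.V) = ({y : Γ.V | (φ y).1 0 = (alphaPt i).1 0} ∩
        {y : Γ.V | (φ y).1 1 = (alphaPt i).1 1}) ∩
        g ⁻¹' {y : Γ.V | (φ y).1 0 = (alphaPt i).1 0} := by
      ext y
      simp only [mem_singleton_iff, mem_inter_iff, mem_ofPred_eq, mem_preimage]
      constructor
      · rintro rfl
        rw [hgx, hx]
        exact ⟨⟨rfl, rfl⟩, rfl⟩
      · rintro ⟨⟨h1, h2⟩, h3⟩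
        rcases hcases y with ⟨k, rfl⟩ | ⟨j, hj⟩
        · rw [hgs, hs, ← h0_betaPt, h0_apply] at h3
          rw [hs] at h2
          exact absurd (h3.symm.trans h2) (alphaPt_no_defect i 0)
        · refine hinj (hj.trans ?_)
          rw [hx]
          rw [hj] at h1
          exact congrArg alphaPt (by simpa [alphaPt_apply] using h1)
    rw [this]
    exact ((hU 0).inter (hU 1)).inter ((hU 0).preimage g.continuous)
  -- Without this edge, `g` fixes all the points above the two-cycle, so the space is discrete and
  -- the parity is a continuous two-coloring.
  have halpha : ∃ x0 x1, φ x0 = alphaPt false ∧ φ x1 = alphaPt true ∧ Γ.graph.Adj x0 x1 := by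
    by_contra hne
    have hdisc (x : Γ.V) : IsOpen {x} := by
      rcases hcases x with ⟨k, rfl⟩ | ⟨i, hi⟩
      · have : ({s k} : Set Γ.V) = φ ⁻¹' {betaPt k} := by
          ext y
          exact ⟨fun h => by rw [mem_singleton_iff.1 h]; exact hs k, fun h => hs_eq h⟩
        rw [this]
        exact (isOpen_singleton_betaPt k).preimage hφ
      · refine hisol hi ?_
        by_contra hgx
        have := hadj _ _ (hg_adj hgx)
        rw [hi, h0_adj_alphaPt] at this
        cases i
        · exact hne ⟨_, _, hi, this, hg_adj hgx⟩
        · exact hne ⟨_, _, this, hi, (hg_adj hgx).symm⟩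
    classical
    let c : Γ.V → Bool := fun x => decide (∃ k, Odd k ∧ x = s k)
    refine hΓ ⟨c, isLocallyConstant_of_isOpen_singleton hdisc _, ?_⟩
    have hodd (k : ℤ) : c (s k) = decide (Odd k) := by
      refine decide_eq_decide.2 ⟨?_, fun h => ⟨k, h, rfl⟩⟩
      rintro ⟨l, hl, h⟩
      rwa [hs_inj h]
    intro x y hxy
    rcases hcases x with ⟨k, rfl⟩ | ⟨i, hi⟩
    · rcases hs2 k y hxy with rfl | rfl
      · rw [hodd, hodd, decide_odd_add_one]
        simp
      · have := decide_odd_add_one (k - 1)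
        rw [sub_add_cancel] at this
        rw [hodd, hodd, this]
        simp
    · have := hadj _ _ hxy
      rw [hi, h0_adj_alphaPt] at this
      cases i
      · exact absurd ⟨x, y, hi, this, hxy⟩ hne
      · exact absurd ⟨y, x, this, hi, hxy.symm⟩ hne
  obtain ⟨x0, x1, hx0, hx1, hx01⟩ := halpha
  have hsurj : Function.Surjective φ := by
    intro z
    rcases K0_cases z with ⟨k, rfl⟩ | ⟨i, rfl⟩
    · exact ⟨s k, hs k⟩
    · cases i
      exacts [⟨x0, hx0⟩, ⟨x1, hx1⟩]
  refine ⟨g, hg, ⟨hinj, hsurj⟩, fun x => ?_⟩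
  rcases hcases x with ⟨k, rfl⟩ | ⟨i, hi⟩
  · rw [hgs, hs, hs, h0_betaPt]
  · have hne : g x ≠ x := by
      have hne01 := hx01.ne
      rw [hg, inducedGraph_adj] at hx01
      intro hgx
      cases i
      · obtain rfl := hinj (hi.trans hx0.symm)
        rcases hx01.2 with h | h
        · exact hne01 (hgx.symm.trans h)
        · exact hne01 (g.injective (hgx.trans h.symm))
      · obtain rfl := hinj (hi.trans hx1.symm)
        rcases hx01.2 with h | h
        · exact hne01 (g.injective (h.trans hgx.symm))
        · exact hne01 (h.symm.trans hgx)
    have := hadj _ _ (hg_adj hne)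
    rw [hi, h0_adj_alphaPt] at this
    rw [this, hi, h0_alphaPt]

theorem below_graphOf_h0_iff {Γ : TopGraph.{u}} {τ : TopologicalSpace K0} :
    Γ.Below (graphOf τ h0) ↔ ∃ φ : Γ.V → K0, Continuous[Γ.top, τ] φ ∧ Function.Injective φ ∧
      ∀ x y, Γ.graph.Adj x y → (inducedGraph h0).Adj (φ x) (φ y) := Iff.rfl

theorem graphOf_h0_below_iff {Γ : TopGraph.{u}} {τ : TopologicalSpace K0} :
    (graphOf τ h0).Below Γ ↔ ∃ φ : K0 → Γ.V, Continuous[τ, Γ.top] φ ∧ Function.Injective φ ∧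
      ∀ x y, (inducedGraph h0).Adj x y → Γ.graph.Adj (φ x) (φ y) := Iff.rfl

theorem adj_iff_of_conj {Γ : TopGraph.{u}} {g : Γ.V → Γ.V} (hg : Γ.graph = inducedGraph g)
    {φ : Γ.V → K0} (hφ : Function.Injective φ) (hconj : ∀ x, φ (g x) = h0 (φ x)) (x y : Γ.V) :
    (inducedGraph h0).Adj (φ x) (φ y) ↔ Γ.graph.Adj x y := by
  rw [hg, inducedGraph_adj, inducedGraph_adj, ← hconj, ← hconj, hφ.ne_iff, hφ.eq_iff, hφ.eq_iff]

/-- A graph induced by a homeomorphism, not continuously two-colorable, and below `K₀`, is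
isomorphic to a refinement of `K₀`. -/
theorem exists_refinement {Γ : TopGraph.{u}} (hΓ : ¬ Γ.HasContColoring Bool)
    (hf : Γ.HomeoInduced) (hb : Γ.Below K0Graph) :
    ∃ τ : TopologicalSpace K0, IsRefinement τ ∧ Γ.Below (graphOf τ h0) ∧
      (graphOf τ h0).Below Γ ∧
      (FirstCountableTopology Γ.V → @FirstCountableTopology K0 τ) := by
  obtain ⟨φ, hφ, hinj, hadj⟩ := below_graphOf_h0_iff.1 hb
  obtain ⟨g, hg, hbij, hconj⟩ := exists_conj hΓ hf hφ hinj hadj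
  have hconj' (x : Γ.V) : φ (g.symm x) = h0.symm (φ x) := by
    rw [Homeomorph.eq_symm_apply, ← hconj, g.apply_symm_apply]
  let e : Γ.V ≃ K0 := Equiv.ofBijective φ hbij
  let τ : TopologicalSpace K0 := TopologicalSpace.coinduced φ Γ.top
  have hφτ : Continuous[Γ.top, τ] φ := continuous_coinduced_rng
  have h1 (z : K0) : φ (e.symm z) = z := e.apply_symm_apply z
  have h2 : τ = TopologicalSpace.induced e.symm Γ.top := (Equiv.induced_symm e ▸ rfl)
  have hback : (graphOf τ h0).Below Γ := by
    refine graphOf_h0_below_iff.2 ⟨e.symm, ?_, e.symm.injective, fun x y hxy => ?_⟩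
    · rw [h2]
      exact continuous_induced_dom
    · rwa [← adj_iff_of_conj hg hinj hconj, h1, h1]
  refine ⟨τ, isRefinement_iff.2 ⟨continuous_iff_coinduced_le.1 hφ, ?_, ?_, ?_⟩, ?_, hback, ?_⟩
  · refine @Continuous.mk _ _ τ τ _ fun U hU => ?_
    have hU' : IsOpen (φ ⁻¹' U) := isOpen_coinduced.1 hU
    have : IsOpen (g ⁻¹' (φ ⁻¹' U)) := hU'.preimage g.continuous
    rw [← preimage_comp, show φ ∘ g = h0 ∘ φ from funext hconj] at this
    exact this
  · refine @Continuous.mk _ _ τ τ _ fun U hU => ?_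
    have hU' : IsOpen (φ ⁻¹' U) := isOpen_coinduced.1 hU
    have : IsOpen (g.symm ⁻¹' (φ ⁻¹' U)) := hU'.preimage g.symm.continuous
    rw [← preimage_comp, show φ ∘ g.symm = h0Inv ∘ φ from funext hconj'] at this
    exact this
  · intro h
    exact hΓ ((below_graphOf_h0_iff.2 ⟨φ, hφτ, hinj, hadj⟩).hasContColoring h)
  · exact below_graphOf_h0_iff.2 ⟨φ, hφτ, hinj, hadj⟩
  · intro hfc
    rw [h2]
    exact TopologicalSpace.firstCountableTopology_induced _ _ _

/-! ### Minimality of `K₀` among the graphs on compact spaces -/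

theorem K0Graph_below_of_bijective {Γ : TopGraph.{u}} [CompactSpace Γ.V] {φ : Γ.V → K0}
    (hφ : Continuous φ) (hbij : Function.Bijective φ)
    (hadj : ∀ x y, (inducedGraph h0).Adj (φ x) (φ y) → Γ.graph.Adj x y) : K0Graph.Below Γ := by
  let e : Γ.V ≃ K0 := Equiv.ofBijective φ hbij
  have he : Continuous e := hφ
  have h1 (z : K0) : φ (e.symm z) = z := e.apply_symm_apply z
  refine graphOf_h0_below_iff.2 ⟨e.symm, he.continuous_symm_of_equiv_compact_to_t2,
    e.symm.injective, fun x y hxy => hadj _ _ ?_⟩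
  rwa [h1, h1]

theorem K0Graph_below_of_homeoInduced {Γ : TopGraph.{u}} [CompactSpace Γ.V]
    (hΓ : ¬ Γ.HasContColoring Bool) (hf : Γ.HomeoInduced) (hb : Γ.Below K0Graph) :
    K0Graph.Below Γ := by
  obtain ⟨φ, hφ, hinj, hadj⟩ := below_graphOf_h0_iff.1 hb
  obtain ⟨g, hg, hbij, hconj⟩ := exists_conj hΓ hf hφ hinj hadj
  exact K0Graph_below_of_bijective hφ hbij fun x y => (adj_iff_of_conj hg hinj hconj x y).1

/-- By compactness the image of the graph is closed. It contains the edges of the orbit of β₀, hence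
their limit (α₀, σ(α₀)), so the rigidity needs no homeomorphism here. -/
theorem K0Graph_below_of_isClosedGraph {Γ : TopGraph.{u}} [CompactSpace Γ.V]
    (hΓ : ¬ Γ.HasContColoring Bool) (hcl : Γ.IsClosedGraph) (hb : Γ.Below K0Graph) :
    K0Graph.Below Γ := by
  obtain ⟨φ, hφ, hinj, hadj⟩ := below_graphOf_h0_iff.1 hb
  have hbeta := exists_adj_betaPt hΓ hφ hadj
  have hclosed : IsClosed (Prod.map φ φ '' {p : Γ.V × Γ.V | Γ.graph.Adj p.1 p.2}) :=
    (hcl.isCompact.image (hφ.prodMap hφ)).isClosed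
  have halpha : (alphaPt false, alphaPt true) ∈
      Prod.map φ φ '' {p : Γ.V × Γ.V | Γ.graph.Adj p.1 p.2} := by
    have h1 := tendsto_betaPt_two_mul_add_one
    have h2 := (h0.continuous.tendsto' _ _ (h0_alphaPt false)).comp h1
    refine hclosed.mem_of_tendsto (h1.prodMk_nhds h2) (Eventually.of_forall fun n => ?_)
    obtain ⟨x, y, hx, hy, hxy⟩ := hbeta (2 * n + 1)
    refine ⟨(x, y), hxy, Prod.ext hx ?_⟩
    rw [Function.comp_apply, h0_betaPt]
    exact hy
  obtain ⟨⟨x0, x1⟩, hx01, hx⟩ := halpha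
  have hx0 : φ x0 = alphaPt false := congrArg Prod.fst hx
  have hx1 : φ x1 = alphaPt true := congrArg Prod.snd hx
  refine K0Graph_below_of_bijective hφ ⟨hinj, fun z => ?_⟩ ?_
  · rcases K0_cases z with ⟨k, rfl⟩ | ⟨i, rfl⟩
    · obtain ⟨x, -, hx, -⟩ := hbeta k
      exact ⟨x, hx⟩
    · cases i
      exacts [⟨x0, hx0⟩, ⟨x1, hx1⟩]
  · have key (x y : Γ.V) (h : h0 (φ x) = φ y) : Γ.graph.Adj x y := by
      rcases K0_cases (φ x) with ⟨k, hk⟩ | ⟨i, hi⟩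
      · obtain ⟨x', y', hx', hy', hxy'⟩ := hbeta k
        rw [hk, h0_betaPt] at h
        rwa [hinj (hk.trans hx'.symm), hinj (h.symm.trans hy'.symm)]
      · rw [hi, h0_alphaPt] at h
        cases i
        · rwa [hinj (hi.trans hx0.symm), hinj (h.symm.trans hx1.symm)]
        · rw [hinj (hi.trans hx1.symm), hinj (h.symm.trans hx0.symm)]
          exact hx01.symm
    intro x y hxy
    rcases (h0_adj _ _).1 hxy with h | h
    · exact key x y h
    · exact (key y x h).symm

theorem isClosedGraph_K0Graph : K0Graph.IsClosedGraph := by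
  have : {p : K0 × K0 | (inducedGraph h0).Adj p.1 p.2} =
      {p | h0 p.1 = p.2} ∪ {p | h0 p.2 = p.1} := by
    ext p
    exact h0_adj p.1 p.2
  show IsClosed {p : K0 × K0 | (inducedGraph h0).Adj p.1 p.2}
  rw [this]
  exact (isClosed_eq (h0.continuous.comp continuous_fst) continuous_snd).union
    (isClosed_eq (h0.continuous.comp continuous_snd) continuous_fst)

theorem homeoInduced_graphOf {X : Type u} {τ : TopologicalSpace X} (e : X ≃ X)
    (h : Continuous e) (h' : Continuous e.symm) : (graphOf τ e).HomeoInduced :=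
  ⟨⟨e, h, h'⟩, rfl⟩

theorem homeoInduced_graphOf_h0 {τ : TopologicalSpace K0} (hτ : IsRefinement τ) :
    (graphOf τ h0).HomeoInduced :=
  homeoInduced_graphOf (@Homeomorph.toEquiv K0 K0 K0Top K0Top h0) hτ.2.1 hτ.2.2.1

/-! ### Incompatible refinements -/

/-- Two filters on `ℤ` are far apart if, for any `c`, they have elements whose members have absolute
values at distance more than `c`. -/
def FarApart (F G : Filter ℤ) : Prop :=
  ∀ c : ℤ, ∃ W ∈ F, ∃ W' ∈ G, ∀ k ∈ W, ∀ l ∈ W', c < |(|k| - |l|)|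

/-- An injective endomorphism of the graph `G_{h₀}` is a translation or a reflection on the orbit of
`β₀`. -/
theorem exists_eq_betaPt {φ : K0 → K0} (hinj : Function.Injective φ)
    (hadj : ∀ x y, (inducedGraph h0).Adj x y → (inducedGraph h0).Adj (φ x) (φ y)) :
    ∃ (m : ℤ → ℤ) (c : ℤ), (∀ k, φ (betaPt k) = betaPt (m k)) ∧
      ((∀ k, m k = c + k) ∨ ∀ k, m k = c - k) := by
  have hsucc (k : ℤ) : (inducedGraph h0).Adj (φ (betaPt k)) (φ (betaPt (k + 1))) :=
    hadj _ _ ((h0_adj_betaPt _ _).2 (Or.inl rfl))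
  have hex (k : ℤ) : ∃ l, φ (betaPt k) = betaPt l := by
    -- A point of the two-cycle has only one neighbor, and cannot be the image of a point with two.
    rcases K0_cases (φ (betaPt k)) with h | ⟨i, hi⟩
    · exact h
    · have h1 := hsucc k
      have h2 := (hsucc (k - 1)).symm
      rw [sub_add_cancel] at h2
      rw [hi, h0_adj_alphaPt] at h1 h2
      have := betaPt_injective (hinj (h1.trans h2.symm))
      omega
  choose m hm using hex
  have hm_inj {k l : ℤ} (h : m k = m l) : k = l :=
    betaPt_injective (hinj (by rw [hm, hm, h]))
  have hstep (k : ℤ) : m (k + 1) = m k + 1 ∨ m (k + 1) = m k - 1 := by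
    have := hsucc k
    rw [hm, hm, h0_adj_betaPt] at this
    exact this.imp (fun h => betaPt_injective h) fun h => betaPt_injective h
  have hdir (k : ℤ) : m (k + 1) = m k + 1 ↔ m (k + 1 + 1) = m (k + 1) + 1 := by
    have h1 := hstep k
    have h2 := hstep (k + 1)
    have h3 : m (k + 1 + 1) ≠ m k := fun h => by
      have := hm_inj h
      omega
    omega
  have hall (k : ℤ) : m (k + 1) = m k + 1 ↔ m (0 + 1) = m 0 + 1 := by
    induction k using Int.inductionOn' (b := 0) with
    | zero => rfl
    | succ k _ ih => rw [← hdir, ih]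
    | pred k _ ih => rw [hdir, sub_add_cancel, ih]
  refine ⟨m, m 0, hm, ?_⟩
  by_cases h : m (0 + 1) = m 0 + 1
  · left
    intro k
    induction k using Int.inductionOn' (b := 0) with
    | zero => simp
    | succ k _ ih =>
      rw [(hall k).2 h, ih]
      ring
    | pred k _ ih =>
      have := (hall (k - 1)).2 h
      rw [sub_add_cancel] at this
      omega
  · right
    have hdec (k : ℤ) : m (k + 1) = m k - 1 :=
      (hstep k).resolve_left fun h' => h ((hall k).1 h')
    intro k
    induction k using Int.inductionOn' (b := 0) with
    | zero => simp
    | succ k _ ih =>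
      rw [hdec, ih]
      ring
    | pred k _ ih =>
      have := hdec (k - 1)
      rw [sub_add_cancel] at this
      omega

theorem exists_tendsto_of_below {τ : TopologicalSpace K0} {F : Filter ℤ}
    (hF : IsLimitFilter F) (h : (graphOf τ h0).Below (graphOf (limitTop F) h0)) :
    ∃ (m : ℤ → ℤ) (c : ℤ), Tendsto m (traceFilter τ) F ∧ ∀ k, |(|m k| - |k|)| ≤ c := by
  obtain ⟨φ, hφ, hinj, hadj⟩ : ∃ φ : K0 → K0, Continuous[τ, limitTop F] φ ∧
      Function.Injective φ ∧
      ∀ x y, (inducedGraph h0).Adj x y → (inducedGraph h0).Adj (φ x) (φ y) := h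
  obtain ⟨m, c, hm, hmc⟩ := exists_eq_betaPt hinj hadj
  have hbound (k : ℤ) : |(|m k| - |k|)| ≤ |c| := by
    rcases hmc with hmc | hmc
    · have := abs_abs_sub_abs_le (c + k) k
      rwa [add_sub_cancel_right, ← hmc] at this
    · have := abs_abs_sub_abs_le (c - k) (-k)
      rwa [abs_neg, sub_neg_eq_add, sub_add_cancel, ← hmc] at this
  have hsurj (l : ℤ) : ∃ k, m k = l := by
    rcases hmc with hmc | hmc
    · exact ⟨l - c, by rw [hmc]; ring⟩
    · exact ⟨c - l, by rw [hmc]; ring⟩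
  have htend (ψ : K0 → K0) (hψ : Continuous[τ, limitTop F] ψ)
      (hψα : ψ (alphaPt false) = alphaPt false) (m' : ℤ → ℤ)
      (hm' : ∀ k, ψ (betaPt k) = betaPt (m' k)) : Tendsto m' (traceFilter τ) F := by
    refine Tendsto.mono_right (tendsto_comap_iff.2 ?_) (traceFilter_limitTop_le F)
    have h1 : Tendsto ψ (@nhds K0 τ (alphaPt false)) (@nhds K0 (limitTop F) (alphaPt false)) :=
      @Continuous.tendsto' K0 K0 τ (limitTop F) _ hψ _ _ hψα
    exact (h1.comp tendsto_comap).congr hm'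
  have halpha : ∃ i, φ (alphaPt false) = alphaPt i := by
    rcases K0_cases (φ (alphaPt false)) with ⟨l, hl⟩ | h
    · obtain ⟨k, rfl⟩ := hsurj l
      rw [← hm] at hl
      exact absurd (hinj hl).symm (betaPt_ne_alphaPt _ _)
    · exact h
  obtain ⟨i, hi⟩ := halpha
  cases i
  · exact ⟨m, |c|, htend φ hφ hi m hm, hbound⟩
  · refine ⟨fun k => m k - 1, |c| + 1, htend (h0Inv ∘ φ) ?_ ?_ _ fun k => ?_, fun k => ?_⟩
    · exact @Continuous.comp K0 K0 K0 τ (limitTop F) (limitTop F) _ _ hF.continuous_h0Inv hφ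
    · rw [Function.comp_apply, hi, h0Inv, h0_symm_alphaPt, Bool.not_true]
    · rw [Function.comp_apply, hm, h0Inv, h0_symm_betaPt]
    · have h1 := abs_abs_sub_abs_le (m k - 1) (m k)
      rw [sub_sub_cancel_left, abs_neg, abs_one] at h1
      have h2 := abs_le.1 h1
      have h3 := abs_le.1 (hbound k)
      show |(|m k - 1| - |k|)| ≤ |c| + 1
      rw [abs_le]
      omega

/-- By rigidity the graph is a refinement τ. For k in the trace of τ, the two maps yield |m k| and
|n k| within c and d of |k|, against a separation larger than c + d. -/
theorem FarApart.not_below {F G : Filter ℤ} (hFG : FarApart F G) (hF : IsLimitFilter F)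
    (hG : IsLimitFilter G) {Γ : TopGraph.{u}} (hΓ : ¬ Γ.HasContColoring Bool)
    (hf : Γ.HomeoInduced) (h1 : Γ.Below (graphOf (limitTop F) h0))
    (h2 : Γ.Below (graphOf (limitTop G) h0)) : False := by
  obtain ⟨τ, hτ, -, hτΓ, -⟩ := exists_refinement hΓ hf
    (h1.trans (graphOf_below_of_le hF.limitTop_le_K0Top h0))
  obtain ⟨m, c, hm, hmc⟩ := exists_tendsto_of_below hF (hτΓ.trans h1)
  obtain ⟨n, d, hn, hnd⟩ := exists_tendsto_of_below hG (hτΓ.trans h2)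
  obtain ⟨W, hW, W', hW', hsep⟩ := hFG (c + d)
  -- `odd` serves only to know that the trace filter is proper.
  obtain ⟨k, -, hkW, hkW'⟩ := (hτ.isLimitFilter.odd.and_eventually
    ((hm.eventually hW).and (hn.eventually hW'))).exists
  have h3 := hsep _ hkW _ hkW'
  have h4 := abs_le.1 (hmc k)
  have h5 := abs_le.1 (hnd k)
  rw [lt_abs] at h3
  omega

/-! ### Filters supported by sparse blocks -/

theorem IsLimitFilter.tendsto_add {F : Filter ℤ} (hF : IsLimitFilter F) (j : ℤ) :
    Tendsto (fun k : ℤ => k + 2 * j) F F := by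
  induction j using Int.inductionOn' (b := 0) with
  | zero => exact tendsto_id.congr fun k => by simp
  | succ j _ ih =>
    refine (hF.add_two.comp ih).congr fun k => ?_
    simp only [Function.comp_apply]
    ring
  | pred j _ ih =>
    refine (hF.sub_two.comp ih).congr fun k => ?_
    simp only [Function.comp_apply]
    ring

/-- The conditions `side (-M)` and `side (M + 1)` prescribe opposite parities on [-M, M]. -/
theorem IsLimitFilter.eventually_lt_abs {F : Filter ℤ} (hF : IsLimitFilter F) (M : ℤ) :
    ∀ᶠ k in F, M < |k| := by
  filter_upwards [hF.side (M + 1), hF.side (-M)] with k h1 h2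
  by_contra h
  have h3 := abs_le.1 (not_lt.1 h)
  have h4 := h1.1 (h2.2 h3.1)
  omega

theorem IsLimitFilter.eventually_block {F : Filter ℤ} (hF : IsLimitFilter F) {U : Set ℤ}
    (hU : U ∈ F) (i : ℕ) (M : ℤ) :
    ∀ᶠ k in F, ∀ j : ℤ, |j| ≤ i → k + 2 * j ∈ U ∧ M < |k + 2 * j| := by
  have h1 : ∀ᶠ k in F, ∀ j ∈ Icc (-(i : ℤ)) i, k + 2 * j ∈ U ∧ M < |k + 2 * j| :=
    (Filter.eventually_all_finite (finite_Icc _ _)).2 fun j _ =>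
      (hF.tendsto_add j).eventually ((eventually_mem_set.2 hU).and (hF.eventually_lt_abs M))
  exact h1.mono fun k hk j hj => hk j (abs_le.1 hj)

/-- The centers `p i` (odd) and `q i` (even) of sparse blocks of integers, the blocks being
separated by the numbers `R i`. -/
structure IsBlockSystem (U : ℕ → Set ℤ) (p q R : ℕ → ℤ) : Prop where
  odd : ∀ i, Odd (p i)
  even : ∀ i, ¬ Odd (q i)
  mono : Monotone R
  mem : ∀ (i : ℕ) (k j : ℤ), |j| ≤ i → k = p i + 2 * j ∨ k = q i + 2 * j →
    k ∈ U i ∧ R i + i < |k| ∧ |k| ≤ R (i + 1)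

/-- Recursion on i: `F` frequently contains odd and even centers whose whole window of radius i, in
steps of 2, lies in `U i` and beyond `R i + i`. The extra i makes the gaps between blocks tend to
infinity. -/
theorem IsLimitFilter.exists_isBlockSystem {F : Filter ℤ} (hF : IsLimitFilter F) {U : ℕ → Set ℤ}
    (hU : ∀ i, U i ∈ F) : ∃ p q R, IsBlockSystem U p q R := by
  have hstep (i : ℕ) (r : ℤ) : ∃ p q r' : ℤ, Odd p ∧ ¬ Odd q ∧ r ≤ r' ∧
      ∀ k j : ℤ, |j| ≤ i → k = p + 2 * j ∨ k = q + 2 * j →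
        k ∈ U i ∧ r + i < |k| ∧ |k| ≤ r' := by
    obtain ⟨p, hp, hp'⟩ := (hF.odd.and_eventually (hF.eventually_block (hU i) i (r + i))).exists
    obtain ⟨q, hq, hq'⟩ := (hF.even.and_eventually (hF.eventually_block (hU i) i (r + i))).exists
    have h1 := le_abs_self r
    have h2 := abs_nonneg r
    have h3 := abs_nonneg p
    have h4 := abs_nonneg q
    have htri (l j : ℤ) : |l + 2 * j| ≤ |l| + 2 * |j| := by
      have := abs_add_le l (2 * j)
      rwa [abs_mul, abs_two] at this
    refine ⟨p, q, |r| + |p| + |q| + 2 * i, hp, hq, by omega, ?_⟩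
    rintro k j hj (rfl | rfl)
    · have := htri p j
      exact ⟨(hp' j hj).1, (hp' j hj).2, by omega⟩
    · have := htri q j
      exact ⟨(hq' j hj).1, (hq' j hj).2, by omega⟩
  choose P Q S hP hQ hS hmem using hstep
  let R : ℕ → ℤ := fun n => Nat.rec 0 S n
  exact ⟨fun i => P i (R i), fun i => Q i (R i), R, fun i => hP _ _, fun i => hQ _ _,
    monotone_nat_of_le_succ fun i => hS _ _, fun i => hmem i (R i)⟩

/-- The integers close to the centers of index in `A` and at least `n`. -/
def blockSet (p q : ℕ → ℤ) (A : Set ℕ) (n : ℕ) : Set ℤ :=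
  {k | ∃ i ∈ A, n ≤ i ∧ ∃ j : ℤ, |j| ≤ (i : ℤ) - n ∧ (k = p i + 2 * j ∨ k = q i + 2 * j)}

/-- The filter generated by the sets `blockSet p q A n`. -/
def blockFilter (p q : ℕ → ℤ) (A : Set ℕ) : Filter ℤ := ⨅ n, 𝓟 (blockSet p q A n)

theorem blockSet_antitone (p q : ℕ → ℤ) (A : Set ℕ) : Antitone (blockSet p q A) := by
  rintro m n hmn k ⟨i, hi, hni, j, hj, hk⟩
  exact ⟨i, hi, hmn.trans hni, j, by omega, hk⟩

theorem hasBasis_blockFilter (p q : ℕ → ℤ) (A : Set ℕ) :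
    (blockFilter p q A).HasBasis (fun _ : ℕ => True) (blockSet p q A) :=
  hasBasis_iInf_principal (blockSet_antitone p q A).directed_ge

theorem blockSet_mem_blockFilter (p q : ℕ → ℤ) (A : Set ℕ) (n : ℕ) :
    blockSet p q A n ∈ blockFilter p q A := (hasBasis_blockFilter p q A).mem_of_mem trivial

instance (p q : ℕ → ℤ) (A : Set ℕ) : (blockFilter p q A).IsCountablyGenerated := by
  rw [blockFilter]
  infer_instance

theorem IsBlockSystem.blockSet_spec {U : ℕ → Set ℤ} {p q R : ℕ → ℤ} (h : IsBlockSystem U p q R)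
    {A : Set ℕ} {n : ℕ} {k : ℤ} (hk : k ∈ blockSet p q A n) :
    ∃ i ∈ A, n ≤ i ∧ k ∈ U i ∧ R i + i < |k| ∧ |k| ≤ R (i + 1) := by
  obtain ⟨i, hi, hni, j, hj, hk⟩ := hk
  exact ⟨i, hi, hni, h.mem i k j (by omega) hk⟩

theorem IsBlockSystem.blockFilter_le {F : Filter ℤ} {U : ℕ → Set ℤ} {p q R : ℕ → ℤ}
    (h : IsBlockSystem U p q R) (hU : F.HasAntitoneBasis U) (A : Set ℕ) :
    blockFilter p q A ≤ F := by
  intro E hE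
  obtain ⟨n, hn⟩ := hU.mem_iff.1 hE
  refine mem_of_superset (blockSet_mem_blockFilter p q A n) fun k hk => ?_
  obtain ⟨i, -, hni, hki, -⟩ := h.blockSet_spec hk
  exact hn (hU.antitone hni hki)

theorem IsBlockSystem.isLimitFilter {F : Filter ℤ} (hF : IsLimitFilter F) {U : ℕ → Set ℤ}
    {p q R : ℕ → ℤ} (h : IsBlockSystem U p q R) (hU : F.HasAntitoneBasis U) {A : Set ℕ}
    (hA : A.Infinite) : IsLimitFilter (blockFilter p q A) := by
  have hle := h.blockFilter_le hU A
  have hbasis := hasBasis_blockFilter p q A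
  refine ⟨fun m => hle (hF.side m), ?_, ?_, ?_, ?_⟩
  · refine (hbasis.tendsto_iff hbasis).2 fun n _ => ⟨n + 1, trivial, ?_⟩
    rintro k ⟨i, hi, hni, j, hj, hk⟩
    refine ⟨i, hi, by omega, j + 1, ?_, ?_⟩
    · rw [abs_le] at hj ⊢
      omega
    · rcases hk with rfl | rfl
      · left; ring
      · right; ring
  · refine (hbasis.tendsto_iff hbasis).2 fun n _ => ⟨n + 1, trivial, ?_⟩
    rintro k ⟨i, hi, hni, j, hj, hk⟩
    refine ⟨i, hi, by omega, j - 1, ?_, ?_⟩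
    · rw [abs_le] at hj ⊢
      omega
    · rcases hk with rfl | rfl
      · left; ring
      · right; ring
  · refine hbasis.frequently_iff.2 fun {n} _ => ?_
    obtain ⟨i, hi, hni⟩ := hA.exists_gt n
    exact ⟨p i, ⟨i, hi, hni.le, 0, by simpa using hni.le, Or.inl (by simp)⟩, h.odd i⟩
  · refine hbasis.frequently_iff.2 fun {n} _ => ?_
    obtain ⟨i, hi, hni⟩ := hA.exists_gt n
    exact ⟨q i, ⟨i, hi, hni.le, 0, by simpa using hni.le, Or.inr (by simp)⟩, h.even i⟩

/-- Beyond the maximum of `A ∩ B` the indices differ. If i < j, the absolute values are at most `R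
(i + 1)` in block i and more than `R j + j` in block j, so they differ by more than j ≥ n ≥ c. -/
theorem IsBlockSystem.farApart {U : ℕ → Set ℤ} {p q R : ℕ → ℤ} (h : IsBlockSystem U p q R)
    {A B : Set ℕ} (hAB : (A ∩ B).Finite) : FarApart (blockFilter p q A) (blockFilter p q B) := by
  intro c
  obtain ⟨N, hN⟩ := hAB.bddAbove
  let n := max (N + 1) c.toNat
  have hc : c ≤ n := (Int.self_le_toNat c).trans (by exact_mod_cast le_max_right _ _)
  have hNn : N < n := Nat.lt_of_succ_le (le_max_left _ _)
  refine ⟨_, blockSet_mem_blockFilter p q A n, _, blockSet_mem_blockFilter p q B n, ?_⟩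
  intro k hk l hl
  obtain ⟨i, hi, hni, -, hk1, hk2⟩ := h.blockSet_spec hk
  obtain ⟨j, hj, hnj, -, hl1, hl2⟩ := h.blockSet_spec hl
  rcases lt_trichotomy i j with hij | rfl | hij
  · have := h.mono (Nat.succ_le_of_lt hij)
    rw [Nat.succ_eq_add_one] at this
    rw [lt_abs]
    right
    omega
  · have := hN ⟨hi, hj⟩
    omega
  · have := h.mono (Nat.succ_le_of_lt hij)
    rw [Nat.succ_eq_add_one] at this
    rw [lt_abs]
    left
    omega

/-- There is an almost disjoint family of size continuum of infinite sets of natural numbers. -/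
theorem exists_almostDisjoint : ∃ A : (ℕ → Bool) → Set ℕ, (∀ x, (A x).Infinite) ∧
    ∀ x y, x ≠ y → (A x ∩ A y).Finite := by
  -- Initial segments are coded by integers: two distinct branches of the binary tree share finitely
  -- many nodes.
  let code : (ℕ → Bool) → ℕ → ℕ := fun x n => Encodable.encode ((List.range n).map x)
  have hcode {x y : ℕ → Bool} {m n : ℕ} (h : code x m = code y n) : m = n ∧ ∀ i < m, x i = y i := by
    have h1 := Encodable.encode_injective h
    obtain rfl : m = n := by simpa using congrArg List.length h1
    refine ⟨rfl, fun i hi => ?_⟩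
    exact List.map_inj_left.1 h1 i (List.mem_range.2 hi)
  refine ⟨fun x => range (code x), fun x => infinite_range_of_injective fun m n h => (hcode h).1,
    fun x y hxy => ?_⟩
  obtain ⟨i, hi⟩ := Function.ne_iff.1 hxy
  refine ((finite_Iic i).image (code x)).subset ?_
  rintro _ ⟨⟨m, rfl⟩, ⟨n, hn⟩⟩
  refine ⟨m, ?_, rfl⟩
  by_contra hm
  exact hi ((hcode hn.symm).2 i (not_le.1 hm))

theorem IsLimitFilter.exists_family {F : Filter ℤ} (hF : IsLimitFilter F)
    [F.IsCountablyGenerated] : ∃ G : (ℕ → Bool) → Filter ℤ,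
      (∀ x, IsLimitFilter (G x) ∧ (G x).IsCountablyGenerated ∧ G x ≤ F) ∧
      ∀ x y, x ≠ y → FarApart (G x) (G y) := by
  obtain ⟨U, hU⟩ := F.exists_antitone_basis
  obtain ⟨p, q, R, h⟩ := hF.exists_isBlockSystem hU.mem
  obtain ⟨A, hA, hdisj⟩ := exists_almostDisjoint
  exact ⟨fun x => blockFilter p q (A x),
    fun x => ⟨h.isLimitFilter hF hU (hA x), inferInstance, h.blockFilter_le hU _⟩,
    fun x y hxy => h.farApart (hdisj x y hxy)⟩

/-! ### Universe lifting -/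

/-- The copy of a graph in a higher universe. -/
def TopGraph.lift (Γ : TopGraph.{0}) : TopGraph.{u} :=
  ⟨ULift.{u} Γ.V, inferInstance, Γ.graph.comap ULift.down⟩

theorem TopGraph.lift_below (Γ : TopGraph.{0}) : TopGraph.Below (TopGraph.lift.{u} Γ) Γ :=
  ⟨ULift.down, continuous_uliftDown, ULift.down_injective, fun _ _ h => h⟩

theorem TopGraph.below_lift (Γ : TopGraph.{0}) : TopGraph.Below Γ (TopGraph.lift.{u} Γ) :=
  ⟨ULift.up, continuous_uliftUp, ULift.up_injective, fun _ _ h => h⟩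

theorem TopGraph.HomeoInduced.lift {Γ : TopGraph.{0}} (h : Γ.HomeoInduced) :
    (TopGraph.lift.{u} Γ).HomeoInduced := by
  obtain ⟨f, hf⟩ := h
  refine ⟨(Homeomorph.ulift.trans f).trans Homeomorph.ulift.symm, ?_⟩
  ext x y
  have h1 : (TopGraph.lift.{u} Γ).graph.Adj x y ↔ (inducedGraph f).Adj x.down y.down := by
    rw [← hf]
    rfl
  have h2 (a b : ULift.{u} Γ.V) : a.down = b.down ↔ a = b := ULift.down_injective.eq_iff
  rw [h1, inducedGraph_adj, inducedGraph_adj]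
  exact and_congr (not_congr (h2 x y)) (or_congr (h2 ⟨f x.down⟩ y) (h2 ⟨f y.down⟩ x))

theorem Is0DP.ulift {X : Type} [TopologicalSpace X] (h : Is0DP X) : Is0DP (ULift.{u} X) :=
  h.of_isClosedEmbedding Homeomorph.ulift.isClosedEmbedding

theorem homeoClass0DP_subset : homeoClass0DP.{u} ⊆ homeoClass0DMS :=
  fun _ hΓ => ⟨hΓ.1.is0DMS, hΓ.2⟩

theorem lift_mem_homeoClass0DP {τ : TopologicalSpace K0} (hτ : IsRefinement τ)
    (hp : @Is0DP K0 τ) : TopGraph.lift.{u} (graphOf τ h0) ∈ homeoClass0DP.{u} := by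
  refine ⟨Is0DP.ulift hp, (homeoInduced_graphOf_h0 hτ).lift, ?_⟩
  rw [TopGraph.three_le_ccn_iff]
  exact fun h => (isRefinement_iff.1 hτ).2.2.2 ((TopGraph.below_lift _).hasContColoring h)

theorem is0DP_K0 : Is0DP K0 := by
  have : PolishSpace Bool := inferInstance
  exact ⟨is0DMC_K0.1, isClosed_K0.polishSpace⟩

/-! ### Strictly decreasing refinements, and bases -/

theorem isCountablyGenerated_traceFilter {τ : TopologicalSpace K0}
    (h : @FirstCountableTopology K0 τ) : (traceFilter τ).IsCountablyGenerated := by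
  have := h.nhds_generated_countable (alphaPt false)
  exact comap.isCountablyGenerated _ _

/-- Below any graph induced by a homeomorphism of a first countable space, which is not continuously
two-colorable and below `K₀`, there are continuum many pairwise incompatible refinements. -/
theorem exists_family_below {Γ : TopGraph.{u}} [FirstCountableTopology Γ.V]
    (hΓ : ¬ Γ.HasContColoring Bool) (hf : Γ.HomeoInduced) (hb : Γ.Below K0Graph) :
    ∃ G : (ℕ → Bool) → Filter ℤ,
      (∀ x, IsLimitFilter (G x) ∧ (G x).IsCountablyGenerated ∧
        (graphOf (limitTop (G x)) h0).Below Γ) ∧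
      ∀ x y, x ≠ y → FarApart (G x) (G y) := by
  obtain ⟨τ, hτ, -, hτΓ, hfc⟩ := exists_refinement hΓ hf hb
  have := isCountablyGenerated_traceFilter (hfc inferInstance)
  obtain ⟨G, hG, hfar⟩ := hτ.isLimitFilter.exists_family
  refine ⟨G, fun x => ⟨(hG x).1, (hG x).2.1, ?_⟩, hfar⟩
  refine (graphOf_below_of_le (limitTop_le hτ.2.1 ?_) h0).trans hτΓ
  exact tendsto_comap.mono_left (hG x).2.2

/-- Of two incompatible refinements below `Γ`, at least one is not above it. -/
theorem exists_strictly_below {Γ : TopGraph.{u}} [FirstCountableTopology Γ.V]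
    (hΓ : ¬ Γ.HasContColoring Bool) (hf : Γ.HomeoInduced) (hb : Γ.Below K0Graph) :
    ∃ τ : TopologicalSpace K0, IsRefinement τ ∧ @Is0DP K0 τ ∧ (graphOf τ h0).Below Γ ∧
      ¬ Γ.Below (graphOf τ h0) := by
  obtain ⟨G, hG, hfar⟩ := exists_family_below hΓ hf hb
  have key (x : ℕ → Bool) (h : ¬ Γ.Below (graphOf (limitTop (G x)) h0)) :
      ∃ τ : TopologicalSpace K0, IsRefinement τ ∧ @Is0DP K0 τ ∧ (graphOf τ h0).Below Γ ∧
        ¬ Γ.Below (graphOf τ h0) := by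
    have := (hG x).2.1
    exact ⟨_, (hG x).1.isRefinement, (hG x).1.is0DP, (hG x).2.2, h⟩
  by_cases h : Γ.Below (graphOf (limitTop (G fun _ => false)) h0)
  · refine key (fun _ => true) fun h' => ?_
    exact (hfar _ _ fun he => by simpa using congrFun he 0).not_below (hG _).1 (hG _).1 hΓ hf h h'
  · exact key _ h

theorem Is0DMS.firstCountableTopology {X : Type u} [TopologicalSpace X] (h : Is0DMS X) :
    FirstCountableTopology X := by
  have := h.2.1
  let _ := TopologicalSpace.metrizableSpaceMetric X
  infer_instance

/-- An element Γ of the basis below `K0` has a refinement strictly below it in the class, and an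
element of the basis below that refinement is comparable to Γ and distinct from it. -/
theorem not_exists_isAntichainBasisFor {C : Set TopGraph.{u}} (h1 : homeoClass0DP ⊆ C)
    (h2 : C ⊆ homeoClass0DMS) : ¬ ∃ B : Set TopGraph.{u}, IsAntichainBasisFor B C := by
  rintro ⟨B, ⟨hBC, hB⟩, hanti⟩
  obtain ⟨Γ, hΓB, hΓ⟩ := hB _ (h1 (lift_mem_homeoClass0DP isRefinement_K0Top is0DP_K0))
  obtain ⟨hΓms, hΓf, hΓc⟩ := h2 (hBC hΓB)
  have := hΓms.firstCountableTopology
  obtain ⟨τ, hτ, hτp, hτΓ, hΓτ⟩ := exists_strictly_below ((TopGraph.three_le_ccn_iff _).1 hΓc) hΓf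
    (hΓ.trans (TopGraph.lift_below _))
  obtain ⟨Δ, hΔB, hΔ⟩ := hB _ (h1 (lift_mem_homeoClass0DP hτ hτp))
  have hΔτ := hΔ.trans (TopGraph.lift_below _)
  by_cases h : Δ = Γ
  · exact hΓτ (h ▸ hΔτ)
  · exact hanti hΔB hΓB h (hΔτ.trans hτΓ)

/-- An element of the basis is below at most one of the continuum many incompatible refinements of
`K0`, and each of these is above some element of the basis. -/
theorem continuum_le_of_isBasisFor {C : Set TopGraph.{u}} (h1 : homeoClass0DP ⊆ C)
    (h2 : C ⊆ homeoClass0DMS) {B : Set TopGraph.{u}} (hB : IsBasisFor B C) : 𝔠 ≤ #B := by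
  have : FirstCountableTopology K0Graph.V := is0DP_K0.is0DMS.firstCountableTopology
  obtain ⟨G, hG, hfar⟩ := exists_family_below not_hasContColoring_K0Graph
    (homeoInduced_graphOf_h0 isRefinement_K0Top) (graphOf_below_of_le le_rfl h0)
  have hex (x : ℕ → Bool) : ∃ Δ ∈ B, Δ.Below (graphOf (limitTop (G x)) h0) := by
    have := (hG x).2.1
    obtain ⟨Δ, hΔ, hΔx⟩ :=
      hB.2 _ (h1 (lift_mem_homeoClass0DP (hG x).1.isRefinement (hG x).1.is0DP))
    exact ⟨Δ, hΔ, hΔx.trans (TopGraph.lift_below _)⟩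
  choose Δ hΔB hΔ using hex
  have hinj : Function.Injective fun x => (⟨Δ x, hΔB x⟩ : B) := by
    intro x y hxy
    have hxy' : Δ x = Δ y := congrArg Subtype.val hxy
    by_contra hne
    obtain ⟨-, hf, hc⟩ := h2 (hB.1 (hΔB x))
    exact (hfar x y hne).not_below (hG x).1 (hG y).1 ((TopGraph.three_le_ccn_iff _).1 hc) hf (hΔ x)
      (hxy' ▸ hΔ y)
  have := Cardinal.lift_mk_le_lift_mk_of_injective hinj
  simpa using this

end ContGraph

theorem theorem1p14 :
    -- `K₀` is a countable 0DMC two-sided subshift, and `h₀` is the restriction of the shift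
    (K0.Countable ∧ Is0DMC K0 ∧ IsClosed K0 ∧ shift '' K0 = K0 ∧
      ∀ x : K0, ((h0 x : K0) : ℤ → Bool) = shift x) ∧
    -- (a) `(K₀, G_{h₀})` has CCN three and is minimal in both classes
    (K0Graph.ccn = 3 ∧
      (K0Graph ∈ frakG.{0} 2 ∧ ∀ Γ ∈ frakG.{u} 2, Γ.Below K0Graph → K0Graph.Below Γ) ∧
      (K0Graph ∈ closedClass.{0} ∧
        ∀ Γ ∈ closedClass.{u}, Γ.Below K0Graph → K0Graph.Below Γ)) ∧
    -- (b) for 0DMS spaces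
    (∀ (S : Type u) (t : TopologicalSpace S) (f : S ≃ₜ S), Is0DMS S →
      3 ≤ (graphOf t f).ccn → (graphOf t f).Below K0Graph →
      ∃ τ : TopologicalSpace K0, IsRefinement τ ∧ @Is0DMS K0 τ ∧
        (graphOf τ h0).Below (graphOf t f) ∧ ¬ (graphOf t f).Below (graphOf τ h0)) ∧
    -- (b) for 0DP spaces
    (∀ (S : Type u) (t : TopologicalSpace S) (f : S ≃ₜ S), Is0DP S →
      3 ≤ (graphOf t f).ccn → (graphOf t f).Below K0Graph →
      ∃ τ : TopologicalSpace K0, IsRefinement τ ∧ @Is0DP K0 τ ∧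
        (graphOf τ h0).Below (graphOf t f) ∧ ¬ (graphOf t f).Below (graphOf τ h0)) ∧
    -- there is no antichain basis
    (¬ ∃ B : Set TopGraph.{u}, IsAntichainBasisFor B homeoClass0DMS) ∧
    (¬ ∃ B : Set TopGraph.{u}, IsAntichainBasisFor B homeoClass0DP) ∧
    -- any basis has size at least continuum
    (∀ B : Set TopGraph.{u}, IsBasisFor B homeoClass0DMS → 𝔠 ≤ #B) ∧
    (∀ B : Set TopGraph.{u}, IsBasisFor B homeoClass0DP → 𝔠 ≤ #B) := by
  have hb (S : Type u) (t : TopologicalSpace S) (f : S ≃ₜ S) (hS : Is0DMS S)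
      (hc : 3 ≤ (graphOf t f).ccn) (hbelow : (graphOf t f).Below K0Graph) :
      ∃ τ : TopologicalSpace K0, IsRefinement τ ∧ @Is0DP K0 τ ∧
        (graphOf τ h0).Below (graphOf t f) ∧ ¬ (graphOf t f).Below (graphOf τ h0) := by
    have : FirstCountableTopology (graphOf t f).V := hS.firstCountableTopology
    exact exists_strictly_below ((TopGraph.three_le_ccn_iff _).1 hc) ⟨f, rfl⟩ hbelow
  have hccn : K0Graph.ccn = 3 := isRefinement_K0Top.2.2.2
  refine ⟨⟨K0_countable, is0DMC_K0, isClosed_K0, image_shift_K0, fun _ => rfl⟩,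
    ⟨hccn, ⟨⟨is0DMC_K0, ⟨h0, rfl⟩, ?_⟩, ?_⟩, ⟨is0DMC_K0, isClosedGraph_K0Graph, hccn.ge⟩, ?_⟩,
    ?_, ?_, ?_, ?_, ?_, ?_⟩
  · exact (TopGraph.two_lt_ccn_iff _).2 not_hasContColoring_K0Graph
  · rintro Γ ⟨⟨-, -, hcomp⟩, hf, hc⟩ hbelow
    exact K0Graph_below_of_homeoInduced ((TopGraph.two_lt_ccn_iff _).1 hc) hf hbelow
  · rintro Γ ⟨⟨-, -, hcomp⟩, hcl, hc⟩ hbelow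
    exact K0Graph_below_of_isClosedGraph ((TopGraph.three_le_ccn_iff _).1 hc) hcl hbelow
  · intro S t f hS hc hbelow
    obtain ⟨τ, hτ, hτp, h1, h2⟩ := hb S t f hS hc hbelow
    exact ⟨τ, hτ, @Is0DP.is0DMS K0 τ hτp, h1, h2⟩
  · intro S t f hS hc hbelow
    exact hb S t f hS.is0DMS hc hbelow
  · exact not_exists_isAntichainBasisFor homeoClass0DP_subset subset_rfl
  · exact not_exists_isAntichainBasisFor subset_rfl homeoClass0DP_subset
  · exact fun B hB => continuum_le_of_isBasisFor homeoClass0DP_subset subset_rfl hB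
  · exact fun B hB => continuum_le_of_isBasisFor subset_rfl homeoClass0DP_subset hB
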